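/- Let $k$ be a field. A \emph{tensor category} is a presentable, compactly generated $k$-linear category with a $k$-bilinear monoidal structure whose tensor product is cocontinuous in each variable and preserves compact objects, and whose unit is compact. A \emph{tensor functor} between tensor categories is a $k$-linear, cocontinuous, strong monoidal functor that preserves compact objects. A tensor category is \emph{rigid} if every compact object has a left and a right dual. An object $m$ of an $\mathcal A$-module category is an \emph{$\mathcal A$-progenerator} if $V\mapsto V\cdot m$ has a right adjoint $\operatorname{act}_m^R$ which is conservative and cocontinuous; $\underline{\operatorname{End}}(m)=\operatorname{act}_m^R(m)$ is the internal endomorphism algebra in $\mathcal A$. Let $F:\mathcal A\to\mathcal B$ be a tensor functor between tensor categories, with $\mathcal A$ rigid, and suppose that $\mathbf 1_{\mathcal B}$ is an $\mathcal A$-progenerator for the action $V\cdot b=F(V)\otimes b$ of $\mathcal A$ on $\mathcal B$. Then $F$ has a right adjoint. Let $F^R$ be any right adjoint of $F$, with unit $\eta$, counit $\varepsilon$ and its canonical lax monoidal structure $\mu_{b,c}:F^R(b)\otimes F^R(c)\to F^R(b\otimes c)$. Put $R=F^R(\mathbf 1_{\mathcal B})$, an algebra in $\mathcal A$, acting on the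 left and on the right of each $F^R(b)$ through $\operatorname{act}_L=\mu_{\mathbf 1,b}$ and $\operatorname{act}_R=\mu_{b,\mathbf 1}$ (followed by the unit isomorphisms). Then $R\cong\underline{\operatorname{End}}(\mathbf 1_{\mathcal B})$ as algebras, compatibly with the evaluation maps to $\mathbf 1_{\mathcal B}$, and: (1) $b\mapsto F^R(b)$ is an equivalence from $\mathcal B$ to the category of left $R$-modules in $\mathcal A$, and also to the category of right $R$-modules in $\mathcal A$. Under these equivalences $F^R$ is the forgetful functor to $\mathcal A$, and $F$ is identified with the free module functor $V\mapsto R\otimes V$, respectively $V\mapsto V\otimes R$, through the canonical maps $\mu_{\mathbf 1,F(V)}\circ(R\otimes\eta_V)$, respectively $\mu_{F(V),\mathbf 1}\circ(\eta_V\otimes R)$ (followed by the unit isomorphisms). (2) These canonical maps give isomorphisms, natural in $V\in\mathcal A$, $$R\otimes V\cong F^R(\mathbf 1_{\mathcal B}\otimes F(V))\cong F^R(F(V)\otimes\mathbf 1_{\mathcal B})\cong V\otimes R .$$ For every $b\in\mathcal B$, composing $R\otimes F^R(b)\cong F^R(\mathbf 1_{\mathcal B}\otimes FF^R(b))\cong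 F^RFF^R(b)$, respectively $F^R(b)\otimes R\cong F^R(FF^R(b)\otimes\mathbf 1_{\mathcal B})\cong F^RFF^R(b)$, with $F^R(\varepsilon_b)$ gives $\operatorname{act}_L$, respectively $\operatorname{act}_R$; hence the resulting isomorphism $\tau_b:R\otimes F^R(b)\cong F^R(b)\otimes R$ satisfies $\operatorname{act}_R\circ\tau_b=\operatorname{act}_L$. The two actions commute, and $b\mapsto F^R(b)$ defines a faithful, $k$-linear, cocontinuous functor $\widetilde{F^R}$ from $\mathcal B$ to the category of $R$-bimodules in $\mathcal A$. (3) $\widetilde{F^R}$ is strong monoidal when $R$-bimodules carry the relative tensor product $$M\otimes_R N=\operatorname{colim}\bigl(M\otimes R\otimes N\rightrightarrows M\otimes N\bigr),$$ with unit $R$: its unit constraint is the identity of $R=F^R(\mathbf 1_{\mathcal B})$, and its tensor constraint $F^R(b)\otimes_R F^R(c)\cong F^R(b\otimes c)$ is induced by $\mu_{b,c}$. -/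

import Mathlib

open CategoryTheory MonoidalCategory Limits

universe v u₁ u₂ w

namespace TensorReconstruction

section Presentable

/-- A monoidal category whose underlying category is presentable and compactly generated, whose
tensor product is cocontinuous in each variable and preserves compact objects, and whose unit is
compact. Together with `k`-bilinearity of the tensor product (`MonoidalLinear k C`), this is a
tensor category (an algebra object) in the 2-category of compactly generated presentable `k`-linear
categories and compact cocontinuous functors. -/
class IsPrTensorCategory (C : Type u₁) [Category.{v} C] [MonoidalCategory C] : Prop where
  locallyFinitelyPresentable : IsLocallyFinitelyPresentable.{v} C
  tensorLeft_cocontinuous (X : C) : PreservesColimitsOfSize.{v, v} (tensorLeft X)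
  tensorRight_cocontinuous (X : C) : PreservesColimitsOfSize.{v, v} (tensorRight X)
  compact_unit : IsFinitelyPresentable.{v} (𝟙_ C)
  compact_tensor (X Y : C) : IsFinitelyPresentable.{v} X → IsFinitelyPresentable.{v} Y →
    IsFinitelyPresentable.{v} (X ⊗ Y)

/-- Rigidity: every compact object has a left and a right dual. -/
class IsRigid (C : Type u₁) [Category.{v} C] [MonoidalCategory C] : Prop where
  hasLeftDual (X : C) : IsFinitelyPresentable.{v} X → Nonempty (HasLeftDual X)
  hasRightDual (X : C) : IsFinitelyPresentable.{v} X → Nonempty (HasRightDual X)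

/-- A (strong) monoidal functor `F` is a tensor functor if it is `k`-linear, cocontinuous and
compact, i.e. preserves compact objects. -/
class IsPrTensorFunctor (k : Type w) [Field k] {A : Type u₁} [Category.{v} A] [MonoidalCategory A]
    [Preadditive A] [Linear k A] {B : Type u₂} [Category.{v} B] [MonoidalCategory B]
    [Preadditive B] [Linear k B] (F : A ⥤ B) [F.Monoidal] : Prop where
  additive : F.Additive
  linear : F.Linear k
  cocontinuous : PreservesColimitsOfSize.{v, v} F
  compact (X : A) : IsFinitelyPresentable.{v} X → IsFinitelyPresentable.{v} (F.obj X)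

variable {C : Type u₁} [Category.{v} C] [MonoidalCategory C] [IsPrTensorCategory C]

instance : HasCoequalizers C := by
  have : HasColimitsOfSize.{v, v} C :=
    (IsPrTensorCategory.locallyFinitelyPresentable (C := C)).toHasColimitsOfSize
  have : HasFiniteColimits C := hasFiniteColimits_of_hasColimitsOfSize.{v, v} C
  infer_instance

instance (X : C) : PreservesColimitsOfSize.{0, 0} (tensorLeft X) := by
  have := IsPrTensorCategory.tensorLeft_cocontinuous X
  exact preservesColimitsOfSize_of_univLE.{v, v} _

instance (X : C) : PreservesColimitsOfSize.{0, 0} (tensorRight X) := by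
  have := IsPrTensorCategory.tensorRight_cocontinuous X
  exact preservesColimitsOfSize_of_univLE.{v, v} _

end Presentable

section Action

variable {A : Type u₁} [Category.{v} A] [MonoidalCategory A]
  {M : Type u₂} [Category.{v} M] [MonoidalLeftAction A M]

open scoped MonoidalLeftAction

variable (A) in
/-- The functor `V ↦ V ⊙ m` from `A` to an `A`-module category, for a fixed object `m`. -/
@[simps]
def act (m : M) : A ⥤ M where
  obj V := V ⊙ₗ m
  map f := f ⊵ₗ m

variable (A) in
/-- An object `m` of an `A`-module category is an `A`-progenerator if the functor `V ↦ V ⊙ m` has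
a right adjoint that is conservative and cocontinuous. -/
def IsProgenerator (m : M) : Prop :=
  ∃ (H : M ⥤ A) (_ : act A m ⊣ H),
    H.ReflectsIsomorphisms ∧ PreservesColimitsOfSize.{v, v} H

section InternalEnd

variable {m : M} {H : M ⥤ A} (adj : act A m ⊣ H)

/-- The evaluation `End(m) ⊙ m ⟶ m`, where `End(m) = H(m)` for `H` right adjoint to
`V ↦ V ⊙ m`. -/
def evalMap : H.obj m ⊙ₗ m ⟶ m := adj.counit.app m

/-- Composition of internal endomorphisms: the map `End(m) ⊗ End(m) ⟶ End(m)` corresponding to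
evaluating twice. -/
def internalComp : H.obj m ⊗ H.obj m ⟶ H.obj m :=
  adj.homEquiv (H.obj m ⊗ H.obj m) m
    ((αₗ _ _ _).hom ≫ H.obj m ⊴ₗ evalMap adj ≫ evalMap adj)

/-- The identity internal endomorphism. -/
def internalId : 𝟙_ A ⟶ H.obj m := adj.homEquiv (𝟙_ A) m (λₗ m).hom

lemma internalComp_eval : internalComp adj ⊵ₗ m ≫ evalMap adj =
    (αₗ _ _ _).hom ≫ H.obj m ⊴ₗ evalMap adj ≫ evalMap adj :=
  (adj.homEquiv_counit _ _ _).symm.trans ((adj.homEquiv _ _).symm_apply_apply _)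

lemma internalId_eval : internalId adj ⊵ₗ m ≫ evalMap adj = (λₗ m).hom :=
  (adj.homEquiv_counit _ _ _).symm.trans ((adj.homEquiv _ _).symm_apply_apply _)

lemma hom_ext_eval {V : A} {f g : V ⟶ H.obj m}
    (h : f ⊵ₗ m ≫ evalMap adj = g ⊵ₗ m ≫ evalMap adj) : f = g := by
  apply (adj.homEquiv V m).symm.injective
  rw [adj.homEquiv_counit, adj.homEquiv_counit]
  exact h

/-- The internal endomorphism algebra `End(m)`: the object `H(m)` with the multiplication and unit
given by composition and identity. -/
@[simps X]
def internalEnd : Mon A where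
  X := H.obj m
  mon :=
    { one := internalId adj
      mul := internalComp adj
      one_mul := by
        apply hom_ext_eval adj
        rw [MonoidalLeftAction.comp_actionHomLeft, Category.assoc, internalComp_eval]
        rw [MonoidalLeftAction.whiskerRight_actionHomLeft]
        simp only [Category.assoc, Iso.inv_hom_id_assoc]
        rw [← MonoidalLeftAction.action_exchange_assoc, internalId_eval]
        simp
      mul_one := by
        apply hom_ext_eval adj
        rw [MonoidalLeftAction.comp_actionHomLeft, Category.assoc, internalComp_eval]
        rw [MonoidalLeftAction.whiskerLeft_actionHomLeft]
        simp only [Category.assoc, Iso.inv_hom_id_assoc]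
        rw [← MonoidalLeftAction.actionHomRight_comp_assoc, internalId_eval]
        simp
      mul_assoc := by
        apply hom_ext_eval adj
        simp only [MonoidalLeftAction.comp_actionHomLeft, Category.assoc, internalComp_eval]
        rw [MonoidalLeftAction.whiskerRight_actionHomLeft,
          MonoidalLeftAction.whiskerLeft_actionHomLeft]
        simp only [Category.assoc, Iso.inv_hom_id_assoc]
        rw [← MonoidalLeftAction.action_exchange_assoc, internalComp_eval]
        rw [← MonoidalLeftAction.actionHomRight_comp_assoc, internalComp_eval]
        simp }

end InternalEnd

end Action

section Induced

variable {A : Type u₁} [Category.{v} A] [MonoidalCategory A]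
  {B : Type u₂} [Category.{v} B] [MonoidalCategory B]

open Functor.LaxMonoidal Functor.OplaxMonoidal Functor.Monoidal

/-- The `A`-module structure `V ⊙ b = F(V) ⊗ b` on `B` induced by a monoidal functor `F`. -/
@[reducible]
def inducedAction (F : A ⥤ B) [F.Monoidal] : MonoidalLeftAction A B where
  actionObj V b := F.obj V ⊗ b
  actionHomLeft f b := F.map f ▷ b
  actionHomRight V _ _ g := F.obj V ◁ g
  actionHom f g := F.map f ⊗ₘ g
  actionAssocIso V W b := whiskerRightIso (μIso F V W).symm b ≪≫ α_ _ _ _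
  actionUnitIso b := whiskerRightIso (εIso F).symm b ≪≫ λ_ b
  actionHom_def f g := MonoidalCategory.tensorHom_def _ _
  actionHomRight_id _ _ := whiskerLeft_id _ _
  id_actionHomLeft _ _ := by simp
  actionHom_comp _ _ _ _ := by simp
  actionAssocIso_hom_naturality f g h := by
    simp only [Iso.trans_hom, whiskerRightIso_hom, Iso.symm_hom, μIso_inv, Category.assoc]
    rw [← associator_naturality, ← tensorHom_id, ← tensorHom_id, tensorHom_comp_tensorHom_assoc,
      tensorHom_comp_tensorHom_assoc, δ_natural, Category.comp_id, Category.id_comp]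
  actionUnitIso_hom_naturality f := by
    simp [whisker_exchange_assoc]
  whiskerLeft_actionHomLeft c _ _ f d := by
    simp only [Iso.trans_hom, Iso.trans_inv, whiskerRightIso_hom, whiskerRightIso_inv,
      Iso.symm_hom, Iso.symm_inv, μIso_inv, μIso_hom, map_whiskerLeft, comp_whiskerRight,
      Category.assoc, whisker_assoc]
  whiskerRight_actionHomLeft c f d := by
    simp only [Iso.trans_hom, Iso.trans_inv, whiskerRightIso_hom, whiskerRightIso_inv,
      Iso.symm_hom, Iso.symm_inv, μIso_inv, μIso_hom, map_whiskerRight, comp_whiskerRight,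
      Category.assoc, whiskerRight_tensor, Iso.hom_inv_id_assoc]
  associator_actionHom c₁ c₂ c₃ d := by
    simp only [Iso.trans_hom, whiskerRightIso_hom, Iso.symm_hom, μIso_inv, Category.assoc,
      MonoidalCategory.whiskerLeft_comp]
    rw [← associator_naturality_left_assoc, ← MonoidalCategory.pentagon,
      ← associator_naturality_middle_assoc]
    simp only [← comp_whiskerRight_assoc]
    rw [Functor.OplaxMonoidal.associativity]
  leftUnitor_actionHom c d := by
    simp only [Iso.trans_hom, whiskerRightIso_hom, Iso.symm_hom, μIso_inv, εIso_inv,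
      Category.assoc]
    rw [map_leftUnitor, ← associator_naturality_left_assoc, comp_whiskerRight, comp_whiskerRight,
      leftUnitor_whiskerRight]
  rightUnitor_actionHom c d := by
    simp only [Iso.trans_hom, whiskerRightIso_hom, Iso.symm_hom, μIso_inv, εIso_inv,
      Category.assoc, MonoidalCategory.whiskerLeft_comp]
    rw [map_rightUnitor, ← associator_naturality_middle_assoc, comp_whiskerRight,
      comp_whiskerRight, triangle]

/-- For the induced action, `V ↦ V ⊙ 𝟙 = F(V) ⊗ 𝟙` is isomorphic to `F`. -/
def actUnitIso (F : A ⥤ B) [F.Monoidal] :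
    letI := inducedAction F
    act A (𝟙_ B) ≅ F :=
  letI := inducedAction F
  NatIso.ofComponents (fun V => ρ_ (F.obj V))
    (fun f => rightUnitor_naturality (F.map f))

end Induced

section Modules

variable {C : Type u₁} [Category.{v} C] [MonoidalCategory C]

open MonObj

/-- A right module over an algebra `R` in a monoidal category. -/
structure RightMod (R : Mon C) where
  X : C
  act : X ⊗ R.X ⟶ X
  act_one : X ◁ η[R.X] ≫ act = (ρ_ X).hom
  act_mul : X ◁ μ[R.X] ≫ act = (α_ X R.X R.X).inv ≫ act ▷ R.X ≫ act

namespace RightMod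

variable {R : Mon C}

@[ext]
structure Hom (M N : RightMod R) where
  hom : M.X ⟶ N.X
  act_hom : M.act ≫ hom = hom ▷ R.X ≫ N.act

instance : Category (RightMod R) where
  Hom M N := Hom M N
  id M := { hom := 𝟙 M.X, act_hom := by simp }
  comp f g :=
    { hom := f.hom ≫ g.hom
      act_hom := by
        rw [← Category.assoc, f.act_hom, Category.assoc, g.act_hom, comp_whiskerRight,
          Category.assoc] }

variable (R) in
/-- The forgetful functor from right modules. -/
def forget : RightMod R ⥤ C where
  obj M := M.X
  map f := f.hom

variable (R) in
/-- The free right module functor `V ↦ V ⊗ R`. -/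
def free : C ⥤ RightMod R where
  obj V :=
    { X := V ⊗ R.X
      act := (α_ _ _ _).hom ≫ V ◁ μ[R.X]
      act_one := by
        rw [tensor_whiskerLeft]
        simp only [Category.assoc, Iso.inv_hom_id_assoc, ← whiskerLeft_comp, MonObj.mul_one]
        simp
      act_mul := by
        simp [← whiskerLeft_comp] }
  map f :=
    { hom := f ▷ R.X
      act_hom := by simp [whisker_exchange] }
  map_id _ := Hom.ext (id_whiskerRight _ _)
  map_comp _ _ := Hom.ext (comp_whiskerRight _ _ _)

end RightMod

/-- The free left module functor `V ↦ R ⊗ V`. -/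
def freeLeft (R : Mon C) : C ⥤ Mod C R.X where
  obj V :=
    { X := R.X ⊗ V
      mod :=
        { smul := (α_ R.X R.X V).inv ≫ μ[R.X] ▷ V
          one_smul := by
            change η[R.X] ▷ (R.X ⊗ V) ≫ (α_ R.X R.X V).inv ≫ μ[R.X] ▷ V = (λ_ (R.X ⊗ V)).hom
            rw [associator_inv_naturality_left_assoc, ← comp_whiskerRight, MonObj.one_mul]
            simp
          mul_smul := by
            change μ[R.X] ▷ (R.X ⊗ V) ≫ (α_ R.X R.X V).inv ≫ μ[R.X] ▷ V =
              (α_ R.X R.X (R.X ⊗ V)).hom ≫ R.X ◁ ((α_ R.X R.X V).inv ≫ μ[R.X] ▷ V) ≫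
                (α_ R.X R.X V).inv ≫ μ[R.X] ▷ V
            rw [associator_inv_naturality_left_assoc, ← comp_whiskerRight, MonObj.mul_assoc]
            simp } }
  map {V W} f := Mod.Hom.mk' (R.X ◁ f) (by
    change ((α_ R.X R.X V).inv ≫ μ[R.X] ▷ V) ≫ R.X ◁ f =
      R.X ◁ R.X ◁ f ≫ (α_ R.X R.X W).inv ≫ μ[R.X] ▷ W
    rw [Category.assoc, ← whisker_exchange]
    simp)
  map_id _ := Mod.Hom.ext (whiskerLeft_id _ _)
  map_comp _ _ := Mod.Hom.ext (whiskerLeft_comp _ _ _)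

variable (R : Mon C)

/-- The left module underlying a bimodule. -/
def bimodToLeft : Bimod R R ⥤ Mod C R.X where
  obj M :=
    { X := M.X
      mod :=
        { smul := M.actLeft
          one_smul := M.one_actLeft
          mul_smul := M.left_assoc } }
  map f := Mod.Hom.mk' f.hom f.left_act_hom

/-- The right module underlying a bimodule. -/
def bimodToRight : Bimod R R ⥤ RightMod R where
  obj M :=
    { X := M.X
      act := M.actRight
      act_one := M.actRight_one
      act_mul := M.right_assoc }
  map f :=
    { hom := f.hom
      act_hom := f.right_act_hom }

/-- The category of `R`-bimodules is monoidal under the relative tensor product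
`M ⊗_R N = coeq (M ⊗ R ⊗ N ⇉ M ⊗ N)`, with unit the regular bimodule. -/
noncomputable instance [HasCoequalizers C] [∀ X : C, PreservesColimitsOfSize.{0, 0} (tensorLeft X)]
    [∀ X : C, PreservesColimitsOfSize.{0, 0} (tensorRight X)] :
    MonoidalCategory (Bimod R R) where
  tensorObj M N := Bimod.tensorBimod M N
  tensorUnit := Bimod.regular R
  whiskerLeft M _ _ f := Bimod.whiskerLeft M f
  whiskerRight f N := Bimod.whiskerRight f N
  tensorHom {M₁ N₁ M₂ N₂} f g := Bimod.whiskerRight f M₂ ≫ Bimod.whiskerLeft N₁ g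
  associator := Bimod.associatorBimod
  leftUnitor := Bimod.leftUnitorBimod
  rightUnitor := Bimod.rightUnitorBimod
  tensorHom_comp_tensorHom f₁ f₂ g₁ g₂ := by
    rw [Bimod.whiskerLeft_comp_bimod, Bimod.comp_whiskerRight_bimod, Category.assoc, Category.assoc,
      ← Category.assoc (Bimod.whiskerLeft _ _), Bimod.whisker_exchange_bimod, Category.assoc]
  id_tensorHom_id _ _ := by
    rw [Bimod.id_whiskerRight_bimod, Bimod.whiskerLeft_id_bimod, Category.id_comp]
  whiskerLeft_id _ _ := Bimod.whiskerLeft_id_bimod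
  id_whiskerRight _ _ := Bimod.id_whiskerRight_bimod
  associator_naturality f g h := by
    simp only [Bimod.comp_whiskerRight_bimod, Bimod.whiskerRight_comp_bimod,
      Bimod.whisker_assoc_bimod, Bimod.comp_whiskerLeft_bimod, Bimod.whiskerLeft_comp_bimod,
      Category.assoc, Iso.inv_hom_id, Iso.inv_hom_id_assoc, Iso.hom_inv_id_assoc,
      Category.comp_id]
  leftUnitor_naturality f := by
    rw [Bimod.id_whiskerLeft_bimod]
    simp
  rightUnitor_naturality f := by
    rw [Bimod.whiskerRight_id_bimod]
    simp
  pentagon := Bimod.pentagon_bimod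
  triangle := Bimod.triangle_bimod

/-- The projection `M ⊗ N ⟶ M ⊗_R N`. -/
noncomputable def relTensorProj {R : Mon C} [HasCoequalizers C]
    [∀ X : C, PreservesColimitsOfSize.{0, 0} (tensorLeft X)]
    [∀ X : C, PreservesColimitsOfSize.{0, 0} (tensorRight X)] (M N : Bimod R R) :
    M.X ⊗ N.X ⟶ (M ⊗ N).X :=
  coequalizer.π (M.actRight ▷ N.X) ((α_ _ _ _).hom ≫ M.X ◁ N.actLeft)

end Modules

section Reconstruction

variable {A : Type u₁} [Category.{v} A] [MonoidalCategory A]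
  {B : Type u₂} [Category.{v} B] [MonoidalCategory B]

open Functor.LaxMonoidal

variable (G : B ⥤ A) [G.LaxMonoidal]

/-- The algebra `G(𝟙)`, for a lax monoidal functor `G`. -/
abbrev unitAlgebra : Mon A := G.mapMon.obj (Mon.trivial B)

/-- The left action `G(𝟙) ⊗ G(b) ⟶ G(𝟙 ⊗ b) ≅ G(b)`. -/
def leftAct (b : B) : G.obj (𝟙_ B) ⊗ G.obj b ⟶ G.obj b :=
  μ G (𝟙_ B) b ≫ G.map (λ_ b).hom

/-- The right action `G(b) ⊗ G(𝟙) ⟶ G(b ⊗ 𝟙) ≅ G(b)`. -/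
def rightAct (b : B) : G.obj b ⊗ G.obj (𝟙_ B) ⟶ G.obj b :=
  μ G b (𝟙_ B) ≫ G.map (ρ_ b).hom

lemma one_leftAct (b : B) : ε G ▷ G.obj b ≫ leftAct G b = (λ_ (G.obj b)).hom := by
  simp [leftAct]

lemma one_rightAct (b : B) : G.obj b ◁ ε G ≫ rightAct G b = (ρ_ (G.obj b)).hom := by
  simp [rightAct]

lemma leftAct_naturality {b c : B} (f : b ⟶ c) :
    leftAct G b ≫ G.map f = G.obj (𝟙_ B) ◁ G.map f ≫ leftAct G c := by
  rw [leftAct, leftAct, Category.assoc, ← G.map_comp, ← leftUnitor_naturality, G.map_comp,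
    ← μ_natural_right_assoc]

lemma rightAct_naturality {b c : B} (f : b ⟶ c) :
    rightAct G b ≫ G.map f = G.map f ▷ G.obj (𝟙_ B) ≫ rightAct G c := by
  rw [rightAct, rightAct, Category.assoc, ← G.map_comp, ← rightUnitor_naturality, G.map_comp,
    ← μ_natural_left_assoc]

lemma mul_leftAct (b : B) : leftAct G (𝟙_ B) ▷ G.obj b ≫ leftAct G b =
    (α_ _ _ _).hom ≫ G.obj (𝟙_ B) ◁ leftAct G b ≫ leftAct G b := by
  simp only [leftAct, comp_whiskerRight, MonoidalCategory.whiskerLeft_comp, Category.assoc,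
    μ_natural_left_assoc, μ_natural_right_assoc]
  rw [← associativity_assoc]
  simp only [← G.map_comp]
  congr 3
  monoidal

lemma mul_rightAct (b : B) : G.obj b ◁ leftAct G (𝟙_ B) ≫ rightAct G b =
    (α_ _ _ _).inv ≫ rightAct G b ▷ G.obj (𝟙_ B) ≫ rightAct G b := by
  simp only [leftAct, rightAct, comp_whiskerRight, MonoidalCategory.whiskerLeft_comp,
    Category.assoc, μ_natural_left_assoc, μ_natural_right_assoc]
  rw [← cancel_epi (α_ _ _ _).hom, ← associativity_assoc]
  simp only [Iso.hom_inv_id_assoc, ← G.map_comp]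
  congr 3
  monoidal

lemma leftAct_rightAct (b : B) : leftAct G b ▷ G.obj (𝟙_ B) ≫ rightAct G b =
    (α_ _ _ _).hom ≫ G.obj (𝟙_ B) ◁ rightAct G b ≫ leftAct G b := by
  simp only [leftAct, rightAct, comp_whiskerRight, MonoidalCategory.whiskerLeft_comp,
    Category.assoc, μ_natural_left_assoc, μ_natural_right_assoc]
  rw [← associativity_assoc]
  simp only [← G.map_comp]
  congr 3
  monoidal

lemma unitAlgebra_one : MonObj.one (X := (unitAlgebra G).X) = ε G :=
  (congrArg (ε G ≫ ·) (G.map_id _)).trans (Category.comp_id _)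

/-- The functor `b ↦ G(b)` from `B` to `G(𝟙)`-bimodules. -/
def toBimod : B ⥤ Bimod (unitAlgebra G) (unitAlgebra G) where
  obj b :=
    { X := G.obj b
      actLeft := leftAct G b
      actRight := rightAct G b
      one_actLeft := by rw [unitAlgebra_one]; exact one_leftAct G b
      left_assoc := mul_leftAct G b
      actRight_one := by rw [unitAlgebra_one]; exact one_rightAct G b
      right_assoc := mul_rightAct G b
      middle_assoc := leftAct_rightAct G b }
  map f :=
    { hom := G.map f
      left_act_hom := leftAct_naturality G f
      right_act_hom := rightAct_naturality G f }
  map_id _ := Bimod.Hom.ext (G.map_id _)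
  map_comp _ _ := Bimod.Hom.ext (G.map_comp _ _)

/-- The functor `b ↦ G(b)` from `B` to left `G(𝟙)`-modules. -/
def toLeftMod : B ⥤ Mod A (unitAlgebra G).X := toBimod G ⋙ bimodToLeft (unitAlgebra G)

/-- The functor `b ↦ G(b)` from `B` to right `G(𝟙)`-modules. -/
def toRightMod : B ⥤ RightMod (unitAlgebra G) := toBimod G ⋙ bimodToRight (unitAlgebra G)

variable {G} {F : A ⥤ B}

/-- The canonical map `G(𝟙) ⊗ V ⟶ G(𝟙) ⊗ G(F(V)) ⟶ G(𝟙 ⊗ F(V))`. -/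
def leftExchange (adj : F ⊣ G) (V : A) : G.obj (𝟙_ B) ⊗ V ⟶ G.obj (𝟙_ B ⊗ F.obj V) :=
  G.obj (𝟙_ B) ◁ adj.unit.app V ≫ μ G (𝟙_ B) (F.obj V)

/-- The canonical map `V ⊗ G(𝟙) ⟶ G(F(V)) ⊗ G(𝟙) ⟶ G(F(V) ⊗ 𝟙)`. -/
def rightExchange (adj : F ⊣ G) (V : A) : V ⊗ G.obj (𝟙_ B) ⟶ G.obj (F.obj V ⊗ 𝟙_ B) :=
  adj.unit.app V ▷ G.obj (𝟙_ B) ≫ μ G (F.obj V) (𝟙_ B)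

end Reconstruction

end TensorReconstruction

open TensorReconstruction

/-!
The functor `G` right adjoint to `F` is conservative and cocontinuous: for the induced action,
`V ↦ V ⊙ 𝟙` is isomorphic to `F`, so `G` is isomorphic to the right adjoint provided by the
progenerator hypothesis.

The heart of the argument is the projection formula: the canonical maps
`G(b) ⊗ V ⟶ G(b ⊗ F(V))` (`rightProj`) and `V ⊗ G(b) ⟶ G(F(V) ⊗ b)` (`leftProj`) are invertible.
For `V` with a dual an inverse can be written down using the coevaluation in `A` and the image under
`F` of the evaluation (`isIso_rightProj`, `isIso_leftProj`). Rigidity makes this apply to compact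
`V`; both sides are cocontinuous in `V` and `A` is generated under filtered colimits by its compact
objects, so the formula holds for all `V` (`isIso_rightProj_of_isRigid`,
`isIso_leftProj_of_isRigid`).

For `b = 𝟙` this gives `G(𝟙) ⊗ V ≅ G(F(V)) ≅ V ⊗ G(𝟙)`, and the actions of `G(𝟙)` on `G(b)`
correspond to `G` of the counit. Left and right `G(𝟙)`-modules are therefore the same as algebras
over the monad `GF`, and the crude monadicity theorem identifies these with `B`
(`isEquivalence_toLeftMod`, `isEquivalence_toRightMod`).

For the monoidal structure, every `c` has the canonical presentation `FGFG(c) ⇉ FG(c) ⟶ c`. Applying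
`G(b ⊗ -)` preserves this coequalizer, and the projection formula turns the result into
`G(b) ⊗ G(𝟙) ⊗ G(c) ⇉ G(b) ⊗ G(c) ⟶ G(b ⊗ c)`. So the lax structure map of `G` exhibits `G(b ⊗ c)`
as the relative tensor product (`isColimitBalancedCofork`), and the functor to bimodules is strong
monoidal (`toBimodCoreMonoidal`).
-/

namespace TensorReconstruction

/-! ### Dual pairs and the projection maps -/

section Projection

variable {A : Type u₁} [Category.{v} A] [MonoidalCategory A]
  {B : Type u₂} [Category.{v} B] [MonoidalCategory B]

open Functor.LaxMonoidal Functor.OplaxMonoidal Functor.Monoidal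

/-- A triangle identity for a dual pair, tensored with `b` on the left. -/
lemma whiskerLeft_coevaluation_evaluation (X Y b : A) [ExactPairing X Y] :
    (ρ_ (b ⊗ Y)).inv ≫ (b ⊗ Y) ◁ η_ X Y ≫ (α_ (b ⊗ Y) X Y).inv ≫
      ((α_ b Y X).hom ≫ b ◁ ε_ X Y ≫ (ρ_ b).hom) ▷ Y = 𝟙 (b ⊗ Y) := by
  have h := congrArg (fun f => b ◁ f) (ExactPairing.coevaluation_evaluation X Y)
  simp only [MonoidalCategory.whiskerLeft_comp] at h
  rw [← cancel_epi (b ◁ (ρ_ Y).hom), ← cancel_mono ((ρ_ b).inv ▷ Y ≫ (α_ _ _ _).hom)]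
  convert h using 1
  · monoidal
  · monoidal

/-- The other triangle identity for a dual pair, tensored with `b` on the right. -/
lemma coevaluation_evaluation_whiskerRight (X Y b : A) [ExactPairing X Y] :
    (λ_ (X ⊗ b)).inv ≫ η_ X Y ▷ (X ⊗ b) ≫ (α_ X Y (X ⊗ b)).hom ≫
      X ◁ ((α_ Y X b).inv ≫ ε_ X Y ▷ b ≫ (λ_ b).hom) = 𝟙 (X ⊗ b) := by
  have h := congrArg (fun f => f ▷ b) (ExactPairing.evaluation_coevaluation X Y)
  simp only [comp_whiskerRight] at h
  rw [← cancel_epi ((λ_ X).hom ▷ b), ← cancel_mono (X ◁ (λ_ b).inv ≫ (α_ _ _ _).inv)]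
  convert h using 1
  · monoidal
  · monoidal

/-- A strong monoidal functor sends dual pairs to dual pairs. -/
@[reducible]
def mapExactPairing (F : A ⥤ B) [F.Monoidal] (X Y : A) [ExactPairing X Y] :
    ExactPairing (F.obj X) (F.obj Y) where
  coevaluation' := ε F ≫ F.map (η_ X Y) ≫ δ F X Y
  evaluation' := μ F Y X ≫ F.map (ε_ X Y) ≫ η F
  coevaluation_evaluation' := by
    have h := congrArg (fun f => F.map f) (ExactPairing.coevaluation_evaluation X Y)
    simp only [F.map_comp, map_whiskerLeft, map_whiskerRight, map_associator_inv, Category.assoc,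
      μ_δ_assoc, map_rightUnitor, map_leftUnitor_inv] at h
    rw [← cancel_epi (F.obj Y ◁ η F), ← cancel_mono (ε F ▷ F.obj Y),
      ← cancel_epi (δ F Y (𝟙_ A)), ← cancel_mono (μ F (𝟙_ A) Y)]
    simpa using h
  evaluation_coevaluation' := by
    have h := congrArg (fun f => F.map f) (ExactPairing.evaluation_coevaluation X Y)
    simp only [F.map_comp, map_whiskerLeft, map_whiskerRight, map_associator, Category.assoc,
      μ_δ_assoc, map_rightUnitor_inv, map_leftUnitor] at h
    rw [← cancel_epi (η F ▷ F.obj X), ← cancel_mono (F.obj X ◁ ε F),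
      ← cancel_epi (δ F (𝟙_ A) X), ← cancel_mono (μ F X (𝟙_ A))]
    simpa using h

variable {F : A ⥤ B} {G : B ⥤ A} [G.LaxMonoidal] (adj : F ⊣ G)

/-- The projection map `G(b) ⊗ V ⟶ G(b) ⊗ G(F(V)) ⟶ G(b ⊗ F(V))`. -/
def rightProj (b : B) (V : A) : G.obj b ⊗ V ⟶ G.obj (b ⊗ F.obj V) :=
  G.obj b ◁ adj.unit.app V ≫ μ G b (F.obj V)

/-- The projection map `V ⊗ G(b) ⟶ G(F(V)) ⊗ G(b) ⟶ G(F(V) ⊗ b)`. -/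
def leftProj (V : A) (b : B) : V ⊗ G.obj b ⟶ G.obj (F.obj V ⊗ b) :=
  adj.unit.app V ▷ G.obj b ≫ μ G (F.obj V) b

lemma rightProj_naturality (b : B) {V W : A} (f : V ⟶ W) :
    G.obj b ◁ f ≫ rightProj adj b W = rightProj adj b V ≫ G.map (b ◁ F.map f) := by
  have h := adj.unit.naturality f
  dsimp at h
  rw [rightProj, rightProj, Category.assoc, ← μ_natural_right, ← whiskerLeft_comp_assoc,
    ← whiskerLeft_comp_assoc, h]

lemma leftProj_naturality (b : B) {V W : A} (f : V ⟶ W) :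
    f ▷ G.obj b ≫ leftProj adj W b = leftProj adj V b ≫ G.map (F.map f ▷ b) := by
  have h := adj.unit.naturality f
  dsimp at h
  rw [leftProj, leftProj, Category.assoc, ← μ_natural_left, ← comp_whiskerRight_assoc,
    ← comp_whiskerRight_assoc, h]

lemma map_whiskerRight_rightProj {b c : B} (g : b ⟶ c) (V : A) :
    G.map g ▷ V ≫ rightProj adj c V = rightProj adj b V ≫ G.map (g ▷ F.obj V) := by
  have h := whisker_exchange_assoc (G.map g) (adj.unit.app V) (μ G c (F.obj V))
  dsimp at h
  rw [rightProj, rightProj, Category.assoc, ← μ_natural_left, h]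

lemma whiskerLeft_map_leftProj {b c : B} (g : b ⟶ c) (V : A) :
    V ◁ G.map g ≫ leftProj adj V c = leftProj adj V b ≫ G.map (F.obj V ◁ g) := by
  have h := whisker_exchange_assoc (adj.unit.app V) (G.map g) (μ G (F.obj V) c)
  dsimp at h
  rw [leftProj, leftProj, Category.assoc, ← μ_natural_right, h]

variable [F.Monoidal] [adj.IsMonoidal]

lemma rightProj_unit (b : B) :
    rightProj adj b (𝟙_ A) = (ρ_ _).hom ≫ G.map ((ρ_ b).inv ≫ b ◁ ε F) := by
  have h : rightProj adj b (𝟙_ A) ≫ G.map (b ◁ η F) = (ρ_ _).hom ≫ G.map (ρ_ b).inv := by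
    rw [rightProj, Category.assoc, ← μ_natural_right, ← whiskerLeft_comp_assoc,
      adj.unit_app_unit_comp_map_η, Functor.LaxMonoidal.right_unitality]
    simp
  rw [G.map_comp, ← reassoc_of% h, ← G.map_comp, ← MonoidalCategory.whiskerLeft_comp]
  simp

lemma leftProj_unit (b : B) :
    leftProj adj (𝟙_ A) b = (λ_ _).hom ≫ G.map ((λ_ b).inv ≫ ε F ▷ b) := by
  have h : leftProj adj (𝟙_ A) b ≫ G.map (η F ▷ b) = (λ_ _).hom ≫ G.map (λ_ b).inv := by
    rw [leftProj, Category.assoc, ← μ_natural_left, ← comp_whiskerRight_assoc,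
      adj.unit_app_unit_comp_map_η, Functor.LaxMonoidal.left_unitality]
    simp
  rw [G.map_comp, ← reassoc_of% h, ← G.map_comp, ← MonoidalCategory.comp_whiskerRight]
  simp

/-- Projecting past `V ⊗ W` is projecting past `V` and then past `W`. -/
lemma rightProj_tensor (b : B) (V W : A) :
    rightProj adj b V ▷ W ≫ rightProj adj (b ⊗ F.obj V) W =
      (α_ _ _ _).hom ≫ rightProj adj b (V ⊗ W) ≫
        G.map (b ◁ δ F V W ≫ (α_ b (F.obj V) (F.obj W)).inv) := by
  have h := adj.unit_app_tensor_comp_map_δ V W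
  have h' := whisker_exchange (μ G b (F.obj V)) (adj.unit.app W)
  dsimp at h'
  simp only [rightProj, Category.assoc, G.map_comp]
  rw [← μ_natural_right_assoc, ← whiskerLeft_comp_assoc, h, comp_whiskerRight_assoc,
    ← reassoc_of% h', ← cancel_mono (G.map (α_ _ _ _).hom)]
  simp only [Category.assoc, Functor.LaxMonoidal.associativity, ← G.map_comp, Iso.inv_hom_id,
    G.map_id, Category.comp_id, MonoidalCategory.tensorHom_def, MonoidalCategory.whiskerLeft_comp]
  simp

/-- Projecting past `V ⊗ W` is projecting past `W` and then past `V`. -/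
lemma leftProj_tensor (b : B) (V W : A) :
    V ◁ leftProj adj W b ≫ leftProj adj V (F.obj W ⊗ b) =
      (α_ _ _ _).inv ≫ leftProj adj (V ⊗ W) b ≫
        G.map (δ F V W ▷ b ≫ (α_ (F.obj V) (F.obj W) b).hom) := by
  have h := adj.unit_app_tensor_comp_map_δ V W
  have h' := whisker_exchange (adj.unit.app V) (μ G (F.obj W) b)
  dsimp at h'
  simp only [leftProj, Category.assoc, G.map_comp]
  rw [← μ_natural_left_assoc, ← comp_whiskerRight_assoc, h, whiskerLeft_comp_assoc,
    reassoc_of% h', comp_whiskerRight_assoc, Functor.LaxMonoidal.associativity, tensorHom_def']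
  simp

/-- The inverse of `rightProj adj b Y` for `Y` with dual `X`. -/
def rightProjInv (b : B) (X Y : A) [ExactPairing X Y] :
    G.obj (b ⊗ F.obj Y) ⟶ G.obj b ⊗ Y :=
  letI := mapExactPairing F X Y
  (ρ_ _).inv ≫ G.obj (b ⊗ F.obj Y) ◁ η_ X Y ≫ (α_ _ X Y).inv ≫
    (rightProj adj (b ⊗ F.obj Y) X ≫ G.map ((α_ b (F.obj Y) (F.obj X)).hom ≫
      b ◁ ε_ (F.obj X) (F.obj Y) ≫ (ρ_ b).hom)) ▷ Y

/-- The projection map is invertible at dualizable objects. -/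
lemma isIso_rightProj (b : B) (X Y : A) [ExactPairing X Y] : IsIso (rightProj adj b Y) := by
  let := mapExactPairing F X Y
  refine ⟨rightProjInv adj b X Y, ?_, ?_⟩
  · -- Projecting past `Y` and then contracting `F(Y)` with `X` is the evaluation in `A`.
    have key : rightProj adj b Y ▷ X ≫ rightProj adj (b ⊗ F.obj Y) X ≫
        G.map ((α_ b (F.obj Y) (F.obj X)).hom ≫ b ◁ ε_ (F.obj X) (F.obj Y) ≫ (ρ_ b).hom) =
        (α_ _ _ _).hom ≫ G.obj b ◁ ε_ X Y ≫ (ρ_ _).hom := by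
      have e : b ◁ δ F Y X ≫ b ◁ ε_ (F.obj X) (F.obj Y) = b ◁ F.map (ε_ X Y) ≫ b ◁ η F := by
        rw [← MonoidalCategory.whiskerLeft_comp, ← MonoidalCategory.whiskerLeft_comp]
        congr 1
        change δ F Y X ≫ μ F Y X ≫ F.map (ε_ X Y) ≫ η F = _
        simp
      rw [reassoc_of% rightProj_tensor, ← G.map_comp]
      simp only [Category.assoc, Iso.inv_hom_id_assoc]
      rw [reassoc_of% e, G.map_comp, ← reassoc_of% rightProj_naturality, rightProj_unit,
        Category.assoc, ← G.map_comp, Category.assoc, ← MonoidalCategory.whiskerLeft_comp_assoc]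
      simp
    rw [← whiskerLeft_coevaluation_evaluation X Y (G.obj b), ← key]
    simp only [rightProjInv, comp_whiskerRight]
    rw [rightUnitor_inv_naturality_assoc, ← whisker_exchange_assoc,
      associator_inv_naturality_left_assoc]
  · rw [← G.map_id, ← whiskerLeft_coevaluation_evaluation (F.obj X) (F.obj Y) b]
    simp only [rightProjInv, comp_whiskerRight, Category.assoc]
    rw [map_whiskerRight_rightProj, reassoc_of% rightProj_tensor, Iso.inv_hom_id_assoc,
      reassoc_of% rightProj_naturality, rightProj_unit]
    simp only [Category.assoc, Iso.inv_hom_id_assoc, ← G.map_comp]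
    congr 2
    change _ = (b ⊗ F.obj Y) ◁ (ε F ≫ F.map (η_ X Y) ≫ δ F X Y) ≫ _
    simp only [MonoidalCategory.whiskerLeft_comp, comp_whiskerRight, Category.assoc]

/-- The inverse of `leftProj adj X b` for `X` with dual `Y`. -/
def leftProjInv (b : B) (X Y : A) [ExactPairing X Y] :
    G.obj (F.obj X ⊗ b) ⟶ X ⊗ G.obj b :=
  letI := mapExactPairing F X Y
  (λ_ _).inv ≫ η_ X Y ▷ G.obj (F.obj X ⊗ b) ≫ (α_ X Y _).hom ≫
    X ◁ (leftProj adj Y (F.obj X ⊗ b) ≫ G.map ((α_ (F.obj Y) (F.obj X) b).inv ≫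
      ε_ (F.obj X) (F.obj Y) ▷ b ≫ (λ_ b).hom))

/-- The projection map is invertible at dualizable objects. -/
lemma isIso_leftProj (b : B) (X Y : A) [ExactPairing X Y] : IsIso (leftProj adj X b) := by
  let := mapExactPairing F X Y
  refine ⟨leftProjInv adj b X Y, ?_, ?_⟩
  · -- Projecting past `X` and then contracting `F(X)` with `Y` is the evaluation in `A`.
    have key : Y ◁ leftProj adj X b ≫ leftProj adj Y (F.obj X ⊗ b) ≫
        G.map ((α_ (F.obj Y) (F.obj X) b).inv ≫ ε_ (F.obj X) (F.obj Y) ▷ b ≫ (λ_ b).hom) =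
        (α_ _ _ _).inv ≫ ε_ X Y ▷ G.obj b ≫ (λ_ _).hom := by
      have e : δ F Y X ▷ b ≫ ε_ (F.obj X) (F.obj Y) ▷ b = F.map (ε_ X Y) ▷ b ≫ η F ▷ b := by
        rw [← comp_whiskerRight, ← comp_whiskerRight]
        congr 1
        change δ F Y X ≫ μ F Y X ≫ F.map (ε_ X Y) ≫ η F = _
        simp
      rw [reassoc_of% leftProj_tensor, ← G.map_comp]
      simp only [Category.assoc, Iso.hom_inv_id_assoc]
      rw [reassoc_of% e, G.map_comp, ← reassoc_of% leftProj_naturality, leftProj_unit,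
        Category.assoc, ← G.map_comp, Category.assoc, ← comp_whiskerRight_assoc]
      simp
    rw [← coevaluation_evaluation_whiskerRight X Y (G.obj b), ← key]
    simp only [leftProjInv, MonoidalCategory.whiskerLeft_comp]
    rw [leftUnitor_inv_naturality_assoc, whisker_exchange_assoc,
      associator_naturality_right_assoc]
  · rw [← G.map_id, ← coevaluation_evaluation_whiskerRight (F.obj X) (F.obj Y) b]
    simp only [leftProjInv, MonoidalCategory.whiskerLeft_comp, Category.assoc]
    rw [whiskerLeft_map_leftProj, reassoc_of% leftProj_tensor, Iso.hom_inv_id_assoc,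
      reassoc_of% leftProj_naturality, leftProj_unit]
    simp only [Category.assoc, Iso.inv_hom_id_assoc, ← G.map_comp]
    congr 2
    change _ = (ε F ≫ F.map (η_ X Y) ≫ δ F X Y) ▷ (F.obj X ⊗ b) ≫ _
    simp only [MonoidalCategory.whiskerLeft_comp, comp_whiskerRight, Category.assoc]

end Projection

/-! ### Extension from compact objects -/

section CompactGeneration

variable {A : Type u₁} [Category.{v} A] [MonoidalCategory A] [IsPrTensorCategory A]

/-- A natural transformation between cocontinuous functors that is invertible on compact objects
is invertible. -/
lemma isIso_app_of_isFinitelyPresentable {D : Type u₂} [Category.{v} D] {P Q : A ⥤ D}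
    [PreservesColimitsOfSize.{v, v} P] [PreservesColimitsOfSize.{v, v} Q] (t : P ⟶ Q)
    (h : ∀ X : A, IsFinitelyPresentable.{v} X → IsIso (t.app X)) (X : A) : IsIso (t.app X) := by
  have := IsPrTensorCategory.locallyFinitelyPresentable (C := A)
  let := Cardinal.fact_isRegular_aleph0.{v}
  obtain ⟨S, _, hS⟩ := HasCardinalFilteredGenerator.exists_generator A Cardinal.aleph0.{v}
  obtain ⟨J, _, _, ⟨p⟩⟩ := hS.exists_colimitsOfShape X
  have (j : J) : IsIso (t.app (p.diag.obj j)) :=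
    h _ (hS.le_isCardinalPresentable _ (p.prop_diag_obj j))
  have : IsIso (Functor.whiskerLeft p.diag t) := by
    have (j : J) : IsIso ((Functor.whiskerLeft p.diag t).app j) := by
      dsimp; infer_instance
    exact NatIso.isIso_of_isIso_app _
  exact isIso_app_coconePt_of_preservesColimit p.diag t p.cocone p.isColimit

end CompactGeneration

/-! ### The projection formula -/

section Rigid

variable {A : Type u₁} [Category.{v} A] [MonoidalCategory A] [IsPrTensorCategory A] [IsRigid A]
  {B : Type u₂} [Category.{v} B] [MonoidalCategory B] [IsPrTensorCategory B]
  {F : A ⥤ B} [F.Monoidal] {G : B ⥤ A} [G.LaxMonoidal] (adj : F ⊣ G) [adj.IsMonoidal]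
  [PreservesColimitsOfSize.{v, v} G]

/-- The projection formula `G(b) ⊗ V ≅ G(b ⊗ F(V))`. -/
lemma isIso_rightProj_of_isRigid (b : B) (V : A) : IsIso (rightProj adj b V) := by
  have := IsPrTensorCategory.tensorLeft_cocontinuous (G.obj b)
  have := IsPrTensorCategory.tensorLeft_cocontinuous b
  have : PreservesColimitsOfSize.{v, v} F := adj.leftAdjoint_preservesColimits
  let t : tensorLeft (G.obj b) ⟶ F ⋙ tensorLeft b ⋙ G :=
    { app := fun V => rightProj adj b V
      naturality := fun _ _ f => rightProj_naturality adj b f }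
  refine isIso_app_of_isFinitelyPresentable t (fun X hX => ?_) V
  obtain ⟨h⟩ := IsRigid.hasLeftDual X hX
  exact isIso_rightProj adj b (ᘁX) X

/-- The projection formula `V ⊗ G(b) ≅ G(F(V) ⊗ b)`. -/
lemma isIso_leftProj_of_isRigid (b : B) (V : A) : IsIso (leftProj adj V b) := by
  have := IsPrTensorCategory.tensorRight_cocontinuous (G.obj b)
  have := IsPrTensorCategory.tensorRight_cocontinuous b
  have : PreservesColimitsOfSize.{v, v} F := adj.leftAdjoint_preservesColimits
  let t : tensorRight (G.obj b) ⟶ F ⋙ tensorRight b ⋙ G :=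
    { app := fun V => leftProj adj V b
      naturality := fun _ _ f => leftProj_naturality adj b f }
  refine isIso_app_of_isFinitelyPresentable t (fun X hX => ?_) V
  obtain ⟨h⟩ := IsRigid.hasRightDual X hX
  exact isIso_leftProj adj b X (Xᘁ)

end Rigid

/-! ### Monadicity of the right adjoint -/

section Monadic

variable {A : Type u₁} [Category.{v} A] {B : Type u₂} [Category.{v} B]
  {F : A ⥤ B} {G : B ⥤ A} (adj : F ⊣ G)

/-- `B` is the category of algebras over `GF`, by the crude monadicity theorem. -/
lemma isEquivalence_comparison [HasColimitsOfSize.{v, v} B] [G.ReflectsIsomorphisms]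
    [PreservesColimitsOfSize.{v, v} G] : (Monad.comparison adj).IsEquivalence := by
  have : HasFiniteColimits B := hasFiniteColimits_of_hasColimitsOfSize.{v, v} B
  have : PreservesColimitsOfSize.{0, 0} G := preservesColimitsOfSize_of_univLE.{v, v} G
  have : Monad.PreservesColimitOfIsReflexivePair G := ⟨fun _ _ _ => inferInstance⟩
  exact (Monad.monadicOfHasPreservesReflexiveCoequalizersOfReflectsIsomorphisms adj).eqv

variable [(Monad.comparison adj).IsEquivalence]

include adj in
lemma faithful_of_comparison : G.Faithful :=
  Functor.Faithful.of_iso (Monad.comparisonForget adj)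

/-- Morphisms of algebras over `GF` between images of objects of `B` come from `B`. -/
lemma exists_map_eq_of_comm {b c : B} (g : G.obj b ⟶ G.obj c)
    (hg : G.map (F.map g) ≫ G.map (adj.counit.app c) = G.map (adj.counit.app b) ≫ g) :
    ∃ f : b ⟶ c, G.map f = g := by
  let g' : (Monad.comparison adj).obj b ⟶ (Monad.comparison adj).obj c := { f := g, h := hg }
  exact ⟨(Monad.comparison adj).preimage g',
    congrArg Monad.Algebra.Hom.f ((Monad.comparison adj).map_preimage g')⟩

/-- Every algebra over `GF` comes from an object of `B`. -/
lemma exists_iso_of_algebra (X : A) (a : G.obj (F.obj X) ⟶ X) (unit : adj.unit.app X ≫ a = 𝟙 X)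
    (assoc : G.map (adj.counit.app (F.obj X)) ≫ a = G.map (F.map a) ≫ a) :
    ∃ (b : B) (e : G.obj b ≅ X),
      G.map (F.map e.hom) ≫ a = G.map (adj.counit.app b) ≫ e.hom := by
  let alg : adj.toMonad.Algebra := { A := X, a := a, unit := unit, assoc := assoc }
  let i := (Monad.comparison adj).objObjPreimageIso alg
  exact ⟨(Monad.comparison adj).objPreimage alg, (Monad.forget _).mapIso i, i.hom.h⟩

end Monadic

/-! ### Modules over `G(𝟙)` as algebras over `GF` -/

section ModuleIso

variable {C : Type u₁} [Category.{v} C] [MonoidalCategory C] {R : Mon C}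

/-- A linear isomorphism of underlying objects is an isomorphism of left modules. -/
def leftModIso {M N : Mod C R.X} (e : M.X ≅ N.X)
    (h : (M.mod.smul : R.X ⊗ M.X ⟶ M.X) ≫ e.hom =
      R.X ◁ e.hom ≫ (N.mod.smul : R.X ⊗ N.X ⟶ N.X)) : M ≅ N where
  hom := Mod.Hom.mk' e.hom h
  inv := Mod.Hom.mk' e.inv
    (show (N.mod.smul : R.X ⊗ N.X ⟶ N.X) ≫ e.inv =
        R.X ◁ e.inv ≫ (M.mod.smul : R.X ⊗ M.X ⟶ M.X) by
      rw [← cancel_mono e.hom, Category.assoc, Category.assoc, h, ← whiskerLeft_comp_assoc]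
      simp)
  hom_inv_id := Mod.hom_ext _ _ e.hom_inv_id
  inv_hom_id := Mod.hom_ext _ _ e.inv_hom_id

/-- A linear isomorphism of underlying objects is an isomorphism of right modules. -/
def rightModIso {M N : RightMod R} (e : M.X ≅ N.X) (h : M.act ≫ e.hom = e.hom ▷ R.X ≫ N.act) :
    M ≅ N where
  hom := { hom := e.hom, act_hom := h }
  inv :=
    { hom := e.inv
      act_hom := by
        rw [← cancel_mono e.hom, Category.assoc, Category.assoc, h, ← comp_whiskerRight_assoc]
        simp }
  hom_inv_id := RightMod.Hom.ext e.hom_inv_id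
  inv_hom_id := RightMod.Hom.ext e.inv_hom_id

end ModuleIso

section Modules

variable {A : Type u₁} [Category.{v} A] [MonoidalCategory A]
  {B : Type u₂} [Category.{v} B] [MonoidalCategory B]
  {F : A ⥤ B} {G : B ⥤ A} [G.LaxMonoidal] (adj : F ⊣ G)

open Functor.LaxMonoidal

/-- The canonical map `G(𝟙) ⊗ V ⟶ G(F(V))` out of the free left module. -/
def leftFreeMap (V : A) : G.obj (𝟙_ B) ⊗ V ⟶ G.obj (F.obj V) :=
  leftExchange adj V ≫ G.map (λ_ (F.obj V)).hom

/-- The canonical map `V ⊗ G(𝟙) ⟶ G(F(V))` out of the free right module. -/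
def rightFreeMap (V : A) : V ⊗ G.obj (𝟙_ B) ⟶ G.obj (F.obj V) :=
  rightExchange adj V ≫ G.map (ρ_ (F.obj V)).hom

lemma leftFreeMap_eq (V : A) :
    leftFreeMap adj V = G.obj (𝟙_ B) ◁ adj.unit.app V ≫ leftAct G (F.obj V) := by
  rw [leftFreeMap, leftExchange, leftAct, Category.assoc]

lemma rightFreeMap_eq (V : A) :
    rightFreeMap adj V = adj.unit.app V ▷ G.obj (𝟙_ B) ≫ rightAct G (F.obj V) := by
  rw [rightFreeMap, rightExchange, rightAct, Category.assoc]

lemma leftFreeMap_naturality {V W : A} (f : V ⟶ W) :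
    G.obj (𝟙_ B) ◁ f ≫ leftFreeMap adj W = leftFreeMap adj V ≫ G.map (F.map f) := by
  have h := adj.unit.naturality f
  dsimp at h
  rw [leftFreeMap_eq, leftFreeMap_eq, Category.assoc, leftAct_naturality,
    ← whiskerLeft_comp_assoc, ← whiskerLeft_comp_assoc, h]

lemma rightFreeMap_naturality {V W : A} (f : V ⟶ W) :
    f ▷ G.obj (𝟙_ B) ≫ rightFreeMap adj W = rightFreeMap adj V ≫ G.map (F.map f) := by
  have h := adj.unit.naturality f
  dsimp at h
  rw [rightFreeMap_eq, rightFreeMap_eq, Category.assoc, rightAct_naturality,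
    ← comp_whiskerRight_assoc, ← comp_whiskerRight_assoc, h]

/-- Under the projection formula, the action on `G(b)` becomes `G` of the counit. -/
lemma leftFreeMap_counit (b : B) :
    leftFreeMap adj (G.obj b) ≫ G.map (adj.counit.app b) = leftAct G b := by
  rw [leftFreeMap_eq, Category.assoc, leftAct_naturality, ← whiskerLeft_comp_assoc,
    adj.right_triangle_components]
  simp

lemma rightFreeMap_counit (b : B) :
    rightFreeMap adj (G.obj b) ≫ G.map (adj.counit.app b) = rightAct G b := by
  rw [rightFreeMap_eq, Category.assoc, rightAct_naturality, ← comp_whiskerRight_assoc,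
    adj.right_triangle_components]
  simp

/-- The map out of the free left module is a module morphism. -/
lemma leftFreeMap_linear (V : A) :
    leftAct G (𝟙_ B) ▷ V ≫ leftFreeMap adj V =
      (α_ _ _ _).hom ≫ G.obj (𝟙_ B) ◁ leftFreeMap adj V ≫ leftAct G (F.obj V) := by
  have h := whisker_exchange (leftAct G (𝟙_ B)) (adj.unit.app V)
  dsimp at h
  rw [leftFreeMap_eq, ← reassoc_of% h, mul_leftAct]
  simp

lemma rightFreeMap_linear (V : A) :
    V ◁ leftAct G (𝟙_ B) ≫ rightFreeMap adj V =
      (α_ _ _ _).inv ≫ rightFreeMap adj V ▷ G.obj (𝟙_ B) ≫ rightAct G (F.obj V) := by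
  have h := whisker_exchange (adj.unit.app V) (leftAct G (𝟙_ B))
  dsimp at h
  rw [rightFreeMap_eq, reassoc_of% h, mul_rightAct]
  simp

lemma one_leftFreeMap (V : A) :
    ε G ▷ V ≫ leftFreeMap adj V = (λ_ V).hom ≫ adj.unit.app V := by
  have h := whisker_exchange (ε G) (adj.unit.app V)
  dsimp at h
  rw [leftFreeMap_eq, ← reassoc_of% h, one_leftAct]
  exact leftUnitor_naturality _

lemma one_rightFreeMap (V : A) :
    V ◁ ε G ≫ rightFreeMap adj V = (ρ_ V).hom ≫ adj.unit.app V := by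
  have h := whisker_exchange (adj.unit.app V) (ε G)
  dsimp at h
  rw [rightFreeMap_eq, reassoc_of% h, one_rightAct]
  exact rightUnitor_naturality _

/-- `F` is the free left module functor. -/
noncomputable def freeLeftIso [∀ V : A, IsIso (leftFreeMap adj V)] :
    freeLeft (unitAlgebra G) ≅ F ⋙ toLeftMod G :=
  NatIso.ofComponents
    (fun V =>
      let i := asIso (leftFreeMap adj V)
      leftModIso (M := (freeLeft (unitAlgebra G)).obj V) (N := (F ⋙ toLeftMod G).obj V) i
        ((Category.assoc _ _ _).trans ((Iso.inv_comp_eq _).2 (leftFreeMap_linear adj V))))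
    (fun f => Mod.hom_ext _ _ (leftFreeMap_naturality adj f))

/-- `F` is the free right module functor. -/
noncomputable def freeRightIso [∀ V : A, IsIso (rightFreeMap adj V)] :
    RightMod.free (unitAlgebra G) ≅ F ⋙ toRightMod G :=
  NatIso.ofComponents
    (fun V =>
      let i := asIso (rightFreeMap adj V)
      rightModIso (M := (RightMod.free (unitAlgebra G)).obj V) (N := (F ⋙ toRightMod G).obj V) i
        ((Category.assoc _ _ _).trans ((Iso.eq_inv_comp _).1 (rightFreeMap_linear adj V))))
    (fun f => RightMod.Hom.ext (rightFreeMap_naturality adj f))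

variable [(Monad.comparison adj).IsEquivalence]

/-- A linear map `G(b) ⟶ G(c)` is a morphism of algebras over `GF`, hence comes from `B`. -/
lemma exists_map_eq_of_leftAct [∀ V : A, IsIso (leftFreeMap adj V)] {b c : B}
    (g : G.obj b ⟶ G.obj c) (hg : leftAct G b ≫ g = G.obj (𝟙_ B) ◁ g ≫ leftAct G c) :
    ∃ f : b ⟶ c, G.map f = g := by
  refine exists_map_eq_of_comm adj g ?_
  rw [← cancel_epi (leftFreeMap adj (G.obj b)), reassoc_of% leftFreeMap_counit, hg,
    ← reassoc_of% leftFreeMap_naturality, leftFreeMap_counit]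

/-- A linear map `G(b) ⟶ G(c)` is a morphism of algebras over `GF`, hence comes from `B`. -/
lemma exists_map_eq_of_rightAct [∀ V : A, IsIso (rightFreeMap adj V)] {b c : B}
    (g : G.obj b ⟶ G.obj c) (hg : rightAct G b ≫ g = g ▷ G.obj (𝟙_ B) ≫ rightAct G c) :
    ∃ f : b ⟶ c, G.map f = g := by
  refine exists_map_eq_of_comm adj g ?_
  rw [← cancel_epi (rightFreeMap adj (G.obj b)), reassoc_of% rightFreeMap_counit, hg,
    ← reassoc_of% rightFreeMap_naturality, rightFreeMap_counit]

/-- A left `G(𝟙)`-module is an algebra over the monad `GF`, hence comes from `B`. -/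
lemma exists_iso_of_leftAction [∀ V : A, IsIso (leftFreeMap adj V)] (X : A)
    (a : G.obj (𝟙_ B) ⊗ X ⟶ X) (one : ε G ▷ X ≫ a = (λ_ X).hom)
    (mul : leftAct G (𝟙_ B) ▷ X ≫ a = (α_ _ _ _).hom ≫ G.obj (𝟙_ B) ◁ a ≫ a) :
    ∃ (b : B) (e : G.obj b ≅ X), leftAct G b ≫ e.hom = G.obj (𝟙_ B) ◁ e.hom ≫ a := by
  obtain ⟨b, e, h⟩ := exists_iso_of_algebra adj X (inv (leftFreeMap adj X) ≫ a)
    (by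
      rw [← cancel_epi (λ_ X).hom, ← reassoc_of% one_leftFreeMap, IsIso.hom_inv_id_assoc, one]
      simp)
    (by
      rw [← cancel_epi (leftFreeMap adj (G.obj (F.obj X))),
        ← cancel_epi (G.obj (𝟙_ B) ◁ leftFreeMap adj X), ← cancel_epi (α_ _ _ _).hom,
        reassoc_of% leftFreeMap_counit, ← reassoc_of% leftFreeMap_linear,
        IsIso.hom_inv_id_assoc, mul,
        ← reassoc_of% leftFreeMap_naturality, IsIso.hom_inv_id_assoc, ← whiskerLeft_comp_assoc,
        IsIso.hom_inv_id_assoc])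
  refine ⟨b, e, ?_⟩
  rw [← leftFreeMap_counit adj b, Category.assoc, ← h, ← reassoc_of% leftFreeMap_naturality,
    IsIso.hom_inv_id_assoc]

/-- A right `G(𝟙)`-module is an algebra over the monad `GF`, hence comes from `B`. -/
lemma exists_iso_of_rightAction [∀ V : A, IsIso (rightFreeMap adj V)] (X : A)
    (a : X ⊗ G.obj (𝟙_ B) ⟶ X) (one : X ◁ ε G ≫ a = (ρ_ X).hom)
    (mul : X ◁ leftAct G (𝟙_ B) ≫ a = (α_ _ _ _).inv ≫ a ▷ G.obj (𝟙_ B) ≫ a) :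
    ∃ (b : B) (e : G.obj b ≅ X), rightAct G b ≫ e.hom = e.hom ▷ G.obj (𝟙_ B) ≫ a := by
  obtain ⟨b, e, h⟩ := exists_iso_of_algebra adj X (inv (rightFreeMap adj X) ≫ a)
    (by
      rw [← cancel_epi (ρ_ X).hom, ← reassoc_of% one_rightFreeMap, IsIso.hom_inv_id_assoc, one]
      simp)
    (by
      rw [← cancel_epi (rightFreeMap adj (G.obj (F.obj X))),
        ← cancel_epi (rightFreeMap adj X ▷ G.obj (𝟙_ B)), ← cancel_epi (α_ _ _ _).inv,
        reassoc_of% rightFreeMap_counit, ← reassoc_of% rightFreeMap_linear,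
        IsIso.hom_inv_id_assoc, mul,
        ← reassoc_of% rightFreeMap_naturality, IsIso.hom_inv_id_assoc, ← comp_whiskerRight_assoc,
        IsIso.hom_inv_id_assoc])
  refine ⟨b, e, ?_⟩
  rw [← rightFreeMap_counit adj b, Category.assoc, ← h, ← reassoc_of% rightFreeMap_naturality,
    IsIso.hom_inv_id_assoc]

lemma isEquivalence_toLeftMod [∀ V : A, IsIso (leftFreeMap adj V)] :
    (toLeftMod G).IsEquivalence := by
  have : G.Faithful := faithful_of_comparison adj
  refine { faithful := ⟨fun h => ?_⟩, full := ⟨fun {b c} g => ?_⟩, essSurj := ⟨fun M => ?_⟩ }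
  · exact G.map_injective (congrArg Mod.Hom.hom h)
  · obtain ⟨f, hf⟩ := exists_map_eq_of_leftAct adj (b := b) (c := c) g.hom g.isModHom.smul_hom
    exact ⟨f, Mod.hom_ext _ _ hf⟩
  · have one := M.mod.one_smul
    rw [unitAlgebra_one] at one
    obtain ⟨b, e, h⟩ := exists_iso_of_leftAction adj M.X M.mod.smul one M.mod.mul_smul
    exact ⟨b, ⟨leftModIso (M := (toLeftMod G).obj b) e h⟩⟩

lemma isEquivalence_toRightMod [∀ V : A, IsIso (rightFreeMap adj V)] :
    (toRightMod G).IsEquivalence := by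
  have : G.Faithful := faithful_of_comparison adj
  refine { faithful := ⟨fun h => ?_⟩, full := ⟨fun {b c} g => ?_⟩, essSurj := ⟨fun M => ?_⟩ }
  · exact G.map_injective (congrArg RightMod.Hom.hom h)
  · obtain ⟨f, hf⟩ := exists_map_eq_of_rightAct adj (b := b) (c := c) g.hom g.act_hom
    exact ⟨f, RightMod.Hom.ext hf⟩
  · have one := M.act_one
    rw [unitAlgebra_one] at one
    obtain ⟨b, e, h⟩ := exists_iso_of_rightAction adj M.X M.act one M.act_mul
    exact ⟨b, ⟨rightModIso (M := (toRightMod G).obj b) e h⟩⟩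

end Modules

/-! ### The relative tensor product of bimodules -/

section RelativeTensor

variable {C : Type u₁} [Category.{v} C] [MonoidalCategory C] [HasCoequalizers C]
    [∀ X : C, PreservesColimitsOfSize.{0, 0} (tensorLeft X)]
    [∀ X : C, PreservesColimitsOfSize.{0, 0} (tensorRight X)] {R : Mon C}

instance (M N : Bimod R R) : Epi (relTensorProj M N) :=
  inferInstanceAs (Epi (coequalizer.π _ _))

instance (X : C) (M N : Bimod R R) : Epi (X ◁ relTensorProj M N) :=
  inferInstanceAs (Epi ((tensorLeft X).map (coequalizer.π _ _)))

instance (X : C) (M N : Bimod R R) : Epi (relTensorProj M N ▷ X) :=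
  inferInstanceAs (Epi ((tensorRight X).map (coequalizer.π _ _)))

lemma relTensorProj_whiskerRight {M M' : Bimod R R} (f : M ⟶ M') (N : Bimod R R) :
    relTensorProj M N ≫ (f ▷ N).hom = f.hom ▷ N.X ≫ relTensorProj M' N :=
  (ι_colimMap _ _).trans rfl

lemma relTensorProj_whiskerLeft (M : Bimod R R) {N N' : Bimod R R} (f : N ⟶ N') :
    relTensorProj M N ≫ (M ◁ f).hom = M.X ◁ f.hom ≫ relTensorProj M N' :=
  (ι_colimMap _ _).trans rfl

lemma whiskerLeft_relTensorProj_actLeft (M N : Bimod R R) :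
    R.X ◁ relTensorProj M N ≫ (M ⊗ N).actLeft =
      (α_ _ _ _).inv ≫ M.actLeft ▷ N.X ≫ relTensorProj M N :=
  Bimod.TensorBimod.whiskerLeft_π_actLeft M N

lemma relTensorProj_whiskerRight_actRight (M N : Bimod R R) :
    relTensorProj M N ▷ R.X ≫ (M ⊗ N).actRight =
      (α_ _ _ _).hom ≫ M.X ◁ N.actRight ≫ relTensorProj M N :=
  Bimod.TensorBimod.π_tensor_id_actRight M N

lemma relTensorProj_associator (M N P : Bimod R R) :
    relTensorProj M N ▷ P.X ≫ relTensorProj (M ⊗ N) P ≫ (α_ M N P).hom.hom =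
      (α_ _ _ _).hom ≫ M.X ◁ relTensorProj N P ≫ relTensorProj M (N ⊗ P) := by
  have h : relTensorProj (M ⊗ N) P ≫ (α_ M N P).hom.hom = Bimod.AssociatorBimod.homAux M N P :=
    coequalizer.π_desc _ _
  rw [h]
  exact π_tensor_id_preserves_coequalizer_inv_desc _ _ _ _

lemma relTensorProj_leftUnitor (M : Bimod R R) :
    relTensorProj (𝟙_ (Bimod R R)) M ≫ (λ_ M).hom.hom = M.actLeft :=
  coequalizer.π_desc _ _

lemma relTensorProj_rightUnitor (M : Bimod R R) :
    relTensorProj M (𝟙_ (Bimod R R)) ≫ (ρ_ M).hom.hom = M.actRight :=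
  coequalizer.π_desc _ _

/-- A balanced map `M ⊗ N ⟶ P` of bimodules that is a coequalizer identifies `P` with the relative
tensor product. -/
noncomputable def relTensorIso {M N P : Bimod R R} {m : M.X ⊗ N.X ⟶ P.X}
    {w : M.actRight ▷ N.X ≫ m = ((α_ _ _ _).hom ≫ M.X ◁ N.actLeft) ≫ m}
    (hm : IsColimit (Cofork.ofπ m w))
    (hl : M.actLeft ▷ N.X ≫ m = (α_ _ _ _).hom ≫ R.X ◁ m ≫ P.actLeft)
    (hr : (α_ _ _ _).hom ≫ M.X ◁ N.actRight ≫ m = m ▷ R.X ≫ P.actRight) : M ⊗ N ≅ P :=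
  let i : (M ⊗ N).X ≅ P.X := (colimit.isColimit _).coconePointUniqueUpToIso hm
  have hi : relTensorProj M N ≫ i.hom = m :=
    (colimit.isColimit _).comp_coconePointUniqueUpToIso_hom hm WalkingParallelPair.one
  Bimod.isoOfIso i
    (by
      rw [← cancel_epi (R.X ◁ relTensorProj M N), reassoc_of% whiskerLeft_relTensorProj_actLeft, hi,
        ← whiskerLeft_comp_assoc, hi, hl, Iso.inv_hom_id_assoc])
    (by
      rw [← cancel_epi (relTensorProj M N ▷ R.X), reassoc_of% relTensorProj_whiskerRight_actRight,
        hi, ← comp_whiskerRight_assoc, hi, hr])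

lemma relTensorProj_relTensorIso_hom {M N P : Bimod R R} {m : M.X ⊗ N.X ⟶ P.X}
    {w : M.actRight ▷ N.X ≫ m = ((α_ _ _ _).hom ≫ M.X ◁ N.actLeft) ≫ m}
    (hm : IsColimit (Cofork.ofπ m w))
    (hl : M.actLeft ▷ N.X ≫ m = (α_ _ _ _).hom ≫ R.X ◁ m ≫ P.actLeft)
    (hr : (α_ _ _ _).hom ≫ M.X ◁ N.actRight ≫ m = m ▷ R.X ≫ P.actRight) :
    relTensorProj M N ≫ (relTensorIso hm hl hr).hom.hom = m :=
  (colimit.isColimit _).comp_coconePointUniqueUpToIso_hom hm WalkingParallelPair.one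

end RelativeTensor

/-! ### `G(b ⊗ c)` as a relative tensor product -/

section Balanced

variable {A : Type u₁} [Category.{v} A] [MonoidalCategory A]
  {B : Type u₂} [Category.{v} B] [MonoidalCategory B]
  {F : A ⥤ B} {G : B ⥤ A} [G.LaxMonoidal] (adj : F ⊣ G)

open Functor.LaxMonoidal

variable (G) in
/-- The lax structure map is balanced over `G(𝟙)`. -/
lemma rightAct_whiskerRight_μ (b c : B) :
    rightAct G b ▷ G.obj c ≫ μ G b c =
      ((α_ _ _ _).hom ≫ G.obj b ◁ leftAct G c) ≫ μ G b c := by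
  simp only [leftAct, rightAct, comp_whiskerRight, MonoidalCategory.whiskerLeft_comp,
    Category.assoc, μ_natural_left, μ_natural_right]
  rw [← associativity_assoc]
  simp only [← G.map_comp]
  congr 3
  monoidal

variable (G) in
lemma leftAct_whiskerRight_μ (b c : B) :
    leftAct G b ▷ G.obj c ≫ μ G b c =
      (α_ _ _ _).hom ≫ G.obj (𝟙_ B) ◁ μ G b c ≫ leftAct G (b ⊗ c) := by
  simp only [leftAct, comp_whiskerRight, Category.assoc, μ_natural_left]
  rw [← associativity_assoc]
  simp only [← G.map_comp]
  congr 3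
  monoidal

variable (G) in
lemma whiskerLeft_rightAct_μ (b c : B) :
    (α_ _ _ _).hom ≫ G.obj b ◁ rightAct G c ≫ μ G b c =
      μ G b c ▷ G.obj (𝟙_ B) ≫ rightAct G (b ⊗ c) := by
  simp only [rightAct, MonoidalCategory.whiskerLeft_comp, Category.assoc, μ_natural_right]
  rw [← associativity_assoc]
  simp only [← G.map_comp]
  congr 3
  monoidal

variable (G) in
/-- The cofork exhibiting `G(b ⊗ c)` as a candidate for `G(b) ⊗_{G(𝟙)} G(c)`. -/
abbrev balancedCofork (b c : B) :
    Cofork (rightAct G b ▷ G.obj c) ((α_ _ _ _).hom ≫ G.obj b ◁ leftAct G c) :=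
  Cofork.ofπ (μ G b c) (rightAct_whiskerRight_μ G b c)

/-- The lax structure map is recovered from the projection map and the counit. -/
lemma rightProj_counit (b c : B) :
    rightProj adj b (G.obj c) ≫ G.map (b ◁ adj.counit.app c) = μ G b c := by
  rw [rightProj, Category.assoc, ← μ_natural_right, ← whiskerLeft_comp_assoc,
    adj.right_triangle_components]
  simp

/-- Under the projection formula, the right action on `G(b)` in `G(b) ⊗ G(𝟙) ⊗ V` becomes `G(b ⊗ -)`
of the counit at `F(V)`; compare `rightProj_counit`. -/
lemma rightAct_whiskerRight_rightProj (b : B) (V : A) :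
    rightAct G b ▷ V ≫ rightProj adj b V =
      (α_ _ _ _).hom ≫ G.obj b ◁ leftFreeMap adj V ≫ μ G b (F.obj V) := by
  have h := whisker_exchange_assoc (rightAct G b) (adj.unit.app V) (μ G b (F.obj V))
  dsimp at h
  rw [rightProj, ← h, rightAct_whiskerRight_μ, leftFreeMap_eq]
  simp

/-- `G(b ⊗ c)` is the relative tensor product of `G(b)` and `G(c)`: under the projection formula
the defining pair of `G(b) ⊗_{G(𝟙)} G(c)` becomes the image under `G(b ⊗ -)` of the canonical
presentation `FGFG(c) ⇉ FG(c) ⟶ c`. -/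
noncomputable def isColimitBalancedCofork [∀ V : A, IsIso (leftFreeMap adj V)]
    [∀ (b : B) (V : A), IsIso (rightProj adj b V)] [HasCoequalizers B] [G.ReflectsIsomorphisms]
    [PreservesColimitsOfSize.{0, 0} G] [∀ b : B, PreservesColimitsOfSize.{0, 0} (tensorLeft b)]
    (b c : B) : IsColimit (balancedCofork G b c) := by
  have : ReflectsColimit (parallelPair (F.map (G.map (adj.counit.app c)))
      (adj.counit.app (F.obj (G.obj c)))) G := reflectsColimit_of_reflectsIsomorphisms _ _
  have hb : IsColimit _ := isColimitCoforkMapOfIsColimit (tensorLeft b ⋙ G)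
    (adj.counit_naturality _)
    (Monad.MonadicityInternal.counitCoequalizerOfReflectsCoequalizer adj c)
  refine Cofork.IsColimit.mk' _ fun s => ?_
  -- The projection formula turns `rightAct` into the counit at `FG(c)` and `leftAct` into `FG` of
  -- the counit at `c`, so a map coequalizing the actions coequalizes the presentation of `c`.
  have hs : G.map (b ◁ F.map (G.map (adj.counit.app c))) ≫ inv (rightProj adj b (G.obj c)) ≫ s.π =
      G.map (b ◁ adj.counit.app (F.obj (G.obj c))) ≫ inv (rightProj adj b (G.obj c)) ≫ s.π := by
    rw [← cancel_epi (rightProj adj b (G.obj (F.obj (G.obj c)))),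
      ← cancel_epi (G.obj b ◁ leftFreeMap adj (G.obj c)), ← cancel_epi (α_ _ _ _).hom,
      reassoc_of% rightProj_counit, ← reassoc_of% rightAct_whiskerRight_rightProj,
      IsIso.hom_inv_id_assoc, ← reassoc_of% rightProj_naturality]
    dsimp only [Functor.id_obj]
    rw [IsIso.hom_inv_id_assoc, ← whiskerLeft_comp_assoc,
      leftFreeMap_counit, s.condition, Category.assoc]
  refine ⟨Cofork.IsColimit.desc hb _ hs, ?_, fun {m} hm => ?_⟩
  · have h := Cofork.IsColimit.π_desc' hb _ hs
    dsimp at h ⊢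
    rw [← rightProj_counit adj b c, Category.assoc, h, IsIso.hom_inv_id_assoc]
  · refine Cofork.IsColimit.hom_ext hb ((?_ : _ = _).trans (Cofork.IsColimit.π_desc' hb _ hs).symm)
    dsimp at hm ⊢
    rw [← hm, ← rightProj_counit adj b c, Category.assoc, IsIso.inv_hom_id_assoc]

end Balanced

/-! ### The strong monoidal functor to bimodules -/

section StrongMonoidal

variable {A : Type u₁} [Category.{v} A] [MonoidalCategory A] [HasCoequalizers A]
  [∀ X : A, PreservesColimitsOfSize.{0, 0} (tensorLeft X)]
  [∀ X : A, PreservesColimitsOfSize.{0, 0} (tensorRight X)]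
  {B : Type u₂} [Category.{v} B] [MonoidalCategory B] (G : B ⥤ A) [G.LaxMonoidal]

open Functor.LaxMonoidal

/-- The unit bimodule `G(𝟙)` is the image of the unit object. -/
noncomputable def toBimodUnitIso :
    𝟙_ (Bimod (unitAlgebra G) (unitAlgebra G)) ≅ (toBimod G).obj (𝟙_ B) :=
  Bimod.isoOfIso (Iso.refl (G.obj (𝟙_ B)))
    ((Category.comp_id _).trans (by
      change leftAct G (𝟙_ B) = G.obj (𝟙_ B) ◁ 𝟙 _ ≫ leftAct G (𝟙_ B)
      simp))
    ((Category.comp_id _).trans (by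
      change leftAct G (𝟙_ B) = 𝟙 _ ▷ G.obj (𝟙_ B) ≫ rightAct G (𝟙_ B)
      simp [leftAct, rightAct, unitors_equal]))

variable {G} (h : ∀ b c : B, IsColimit (balancedCofork G b c))

/-- The isomorphism `G(b) ⊗_{G(𝟙)} G(c) ≅ G(b ⊗ c)` induced by the lax structure map, granted that
the latter is a coequalizer. -/
noncomputable def toBimodTensorIso (b c : B) :
    (toBimod G).obj b ⊗ (toBimod G).obj c ≅ (toBimod G).obj (b ⊗ c) :=
  relTensorIso (h b c) (leftAct_whiskerRight_μ G b c) (whiskerLeft_rightAct_μ G b c)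

variable (G) in
/-- The lax structure map of `G`, as a map between objects underlying bimodules. -/
def toBimodμ (b c : B) : ((toBimod G).obj b).X ⊗ ((toBimod G).obj c).X ⟶
    ((toBimod G).obj (b ⊗ c)).X := μ G b c

lemma relTensorProj_toBimodTensorIso (b c : B) :
    relTensorProj ((toBimod G).obj b) ((toBimod G).obj c) ≫ (toBimodTensorIso h b c).hom.hom =
      toBimodμ G b c :=
  relTensorProj_relTensorIso_hom (h b c) (leftAct_whiskerRight_μ G b c)
    (whiskerLeft_rightAct_μ G b c)

/-- The functor to bimodules is strong monoidal as soon as the lax structure maps are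
coequalizers. -/
noncomputable def toBimodCoreMonoidal : (toBimod G).CoreMonoidal where
  εIso := toBimodUnitIso G
  μIso := toBimodTensorIso h
  μIso_hom_natural_left {b b'} f c := by
    ext
    rw [← cancel_epi (relTensorProj _ _), Bimod.comp_hom', Bimod.comp_hom',
      reassoc_of% relTensorProj_whiskerRight, relTensorProj_toBimodTensorIso,
      reassoc_of% relTensorProj_toBimodTensorIso]
    exact μ_natural_left G f c
  μIso_hom_natural_right {b b'} c f := by
    ext
    rw [← cancel_epi (relTensorProj _ _), Bimod.comp_hom', Bimod.comp_hom',
      reassoc_of% relTensorProj_whiskerLeft, relTensorProj_toBimodTensorIso,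
      reassoc_of% relTensorProj_toBimodTensorIso]
    exact μ_natural_right G c f
  associativity b c d := by
    ext
    rw [← cancel_epi (relTensorProj _ _), ← cancel_epi (relTensorProj _ _ ▷ _)]
    simp only [Bimod.comp_hom']
    rw [reassoc_of% relTensorProj_whiskerRight, reassoc_of% relTensorProj_toBimodTensorIso,
      ← comp_whiskerRight_assoc, relTensorProj_toBimodTensorIso,
      reassoc_of% relTensorProj_associator, reassoc_of% relTensorProj_whiskerLeft,
      relTensorProj_toBimodTensorIso, ← whiskerLeft_comp_assoc, relTensorProj_toBimodTensorIso]
    exact associativity G b c d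
  left_unitality b := by
    ext
    rw [← cancel_epi (relTensorProj _ _), relTensorProj_leftUnitor]
    simp only [Bimod.comp_hom']
    rw [reassoc_of% relTensorProj_whiskerRight, reassoc_of% relTensorProj_toBimodTensorIso]
    change leftAct G b = 𝟙 (G.obj (𝟙_ B)) ▷ G.obj b ≫ leftAct G b
    simp
  right_unitality b := by
    ext
    rw [← cancel_epi (relTensorProj _ _), relTensorProj_rightUnitor]
    simp only [Bimod.comp_hom']
    rw [reassoc_of% relTensorProj_whiskerLeft, reassoc_of% relTensorProj_toBimodTensorIso]
    change rightAct G b = G.obj b ◁ 𝟙 (G.obj (𝟙_ B)) ≫ rightAct G b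
    simp

end StrongMonoidal

/-! ### Colimits of bimodules -/

section Colimits

variable {A : Type u₁} [Category.{v} A] [MonoidalCategory A]
  {B : Type u₂} [Category.{v} B] [MonoidalCategory B] (G : B ⥤ A) [G.LaxMonoidal]

/-- The functor to bimodules is cocontinuous: the map out of `G(colim)` induced on underlying
objects is linear because tensoring with `G(𝟙)` preserves the colimit. -/
lemma preservesColimits_toBimod [PreservesColimitsOfSize.{v, v} G]
    [∀ X : A, PreservesColimitsOfSize.{v, v} (tensorLeft X)]
    [∀ X : A, PreservesColimitsOfSize.{v, v} (tensorRight X)] :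
    PreservesColimitsOfSize.{v, v} (toBimod G) where
  preservesColimitsOfShape {J _} := ⟨fun {K} => ⟨fun {c} hc => ⟨by
    have hG := isColimitOfPreserves G hc
    have hl := isColimitOfPreserves (tensorLeft (G.obj (𝟙_ B))) hG
    have hr := isColimitOfPreserves (tensorRight (G.obj (𝟙_ B))) hG
    let forg : Bimod (unitAlgebra G) (unitAlgebra G) ⥤ A := Bimod.forget _
    let t (s : Cocone (K ⋙ toBimod G)) : G.obj c.pt ⟶ s.pt.X := hG.desc (forg.mapCocone s)
    let f (s : Cocone (K ⋙ toBimod G)) (j : J) : G.obj (K.obj j) ⟶ s.pt.X := (s.ι.app j).hom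
    have ht (s : Cocone (K ⋙ toBimod G)) (j : J) : G.map (c.ι.app j) ≫ t s = f s j :=
      hG.fac (forg.mapCocone s) j
    exact {
      desc := fun s =>
        { hom := t s
          left_act_hom := hl.hom_ext fun j => by
            let a : G.obj (𝟙_ B) ⊗ s.pt.X ⟶ s.pt.X := s.pt.actLeft
            have hj : leftAct G (K.obj j) ≫ f s j = G.obj (𝟙_ B) ◁ f s j ≫ a :=
              (s.ι.app j).left_act_hom
            change G.obj (𝟙_ B) ◁ G.map (c.ι.app j) ≫ leftAct G c.pt ≫ t s =
              G.obj (𝟙_ B) ◁ G.map (c.ι.app j) ≫ G.obj (𝟙_ B) ◁ t s ≫ a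
            rw [← whiskerLeft_comp_assoc, ht, ← hj, ← ht]
            exact (reassoc_of% leftAct_naturality G (c.ι.app j)) (t s) |>.symm
          right_act_hom := hr.hom_ext fun j => by
            let a : s.pt.X ⊗ G.obj (𝟙_ B) ⟶ s.pt.X := s.pt.actRight
            have hj : rightAct G (K.obj j) ≫ f s j = f s j ▷ G.obj (𝟙_ B) ≫ a :=
              (s.ι.app j).right_act_hom
            change G.map (c.ι.app j) ▷ G.obj (𝟙_ B) ≫ rightAct G c.pt ≫ t s =
              G.map (c.ι.app j) ▷ G.obj (𝟙_ B) ≫ t s ▷ G.obj (𝟙_ B) ≫ a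
            rw [← comp_whiskerRight_assoc, ht, ← hj, ← ht]
            exact (reassoc_of% rightAct_naturality G (c.ι.app j)) (t s) |>.symm }
      fac := fun s j => Bimod.hom_ext _ _ (ht s j)
      uniq := fun s m hm => Bimod.hom_ext _ _ (hG.hom_ext fun j =>
        (congrArg Bimod.Hom.hom (hm j)).trans (ht s j).symm) }⟩⟩⟩

end Colimits

/-! ### The internal endomorphism algebra of the unit -/

section InternalEnd

variable {A : Type u₁} [Category.{v} A] [MonoidalCategory A]
  {B : Type u₂} [Category.{v} B] [MonoidalCategory B]
  {F : A ⥤ B} [F.Monoidal] {G : B ⥤ A} [G.LaxMonoidal] (adj : F ⊣ G) [adj.IsMonoidal]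

open Functor.LaxMonoidal Functor.OplaxMonoidal

/-- The adjunct of the multiplication of `G(𝟙)` applies the counit twice. -/
lemma map_leftAct_counit : F.map (leftAct G (𝟙_ B)) ≫ adj.counit.app (𝟙_ B) =
    δ F _ _ ≫ F.obj (G.obj (𝟙_ B)) ◁ adj.counit.app (𝟙_ B) ≫ (ρ_ _).hom ≫
      adj.counit.app (𝟙_ B) := by
  have h := adj.counit.naturality (λ_ (𝟙_ B)).hom
  dsimp at h
  rw [leftAct, F.map_comp, Category.assoc, h,
    adj.map_μ_comp_counit_app_tensor_assoc, MonoidalCategory.tensorHom_def']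
  simp [unitors_equal]

/-- The internal endomorphism algebra of the unit is `G(𝟙)`: both represent
`V ↦ Hom(F(V), 𝟙)`, and both multiplications are adjunct to evaluating twice. -/
lemma exists_internalEnd_iso {H : B ⥤ A} :
    letI : MonoidalLeftAction A B := inducedAction F
    ∀ adjH : act A (𝟙_ B) ⊣ H,
      ∃ e : internalEnd adjH ≅ unitAlgebra G,
        evalMap adjH =
          (ρ_ (F.obj (H.obj (𝟙_ B)))).hom ≫ F.map e.hom.hom ≫ adj.counit.app (𝟙_ B) := by
  let : MonoidalLeftAction A B := inducedAction F
  intro adjH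
  let adj' := Adjunction.ofNatIsoLeft adjH (actUnitIso F)
  let i : H.obj (𝟙_ B) ≅ G.obj (𝟙_ B) := (adj'.rightAdjointUniq adj).app (𝟙_ B)
  let t : F.obj (G.obj (𝟙_ B)) ⟶ 𝟙_ B := adj.counit.app (𝟙_ B)
  have hi : evalMap adjH = (ρ_ (F.obj (H.obj (𝟙_ B)))).hom ≫ F.map i.hom ≫ t := by
    have h : F.map i.hom ≫ t = (ρ_ (F.obj (H.obj (𝟙_ B)))).inv ≫ evalMap adjH :=
      (Adjunction.rightAdjointUniq_hom_app_counit adj' adj (𝟙_ B)).trans (by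
        simp [adj', Adjunction.ofNatIsoLeft, evalMap, -Functor.OplaxMonoidal.right_unitality]
        rfl)
    rw [h, Iso.hom_inv_id_assoc]
  have hone : internalId adjH ≫ i.hom = ε G := by
    have h₀ := internalId_eval adjH
    rw [hi] at h₀
    have h : F.map (internalId adjH) ▷ 𝟙_ B ≫ (ρ_ _).hom ≫ F.map i.hom ≫ t =
      η F ▷ 𝟙_ B ≫ (λ_ (𝟙_ B)).hom := h₀
    apply (adj.homEquiv _ _).symm.injective
    rw [adj.homEquiv_counit, adj.homEquiv_counit, adj.map_ε_comp_counit_app_unit, F.map_comp,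
      Category.assoc, ← cancel_epi (ρ_ _).hom, ← rightUnitor_naturality_assoc]
    refine h.trans ?_
    simp [unitors_equal]
  have hmul : internalComp adjH ≫ i.hom = (i.hom ⊗ₘ i.hom) ≫ leftAct G (𝟙_ B) := by
    have h₀ := internalComp_eval adjH
    rw [hi] at h₀
    have h : F.map (internalComp adjH) ▷ 𝟙_ B ≫ (ρ_ _).hom ≫ F.map i.hom ≫ t =
      (δ F _ _ ▷ 𝟙_ B ≫ (α_ _ _ _).hom) ≫
        F.obj (H.obj (𝟙_ B)) ◁ ((ρ_ _).hom ≫ F.map i.hom ≫ t) ≫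
          (ρ_ _).hom ≫ F.map i.hom ≫ t := h₀
    have ht : F.map (leftAct G (𝟙_ B)) ≫ t =
      δ F _ _ ≫ F.obj (G.obj (𝟙_ B)) ◁ t ≫ (ρ_ _).hom ≫ t := map_leftAct_counit adj
    apply (adj.homEquiv _ _).symm.injective
    rw [adj.homEquiv_counit, adj.homEquiv_counit, F.map_comp, Category.assoc, F.map_comp,
      Category.assoc, ht, ← cancel_epi (ρ_ _).hom, ← rightUnitor_naturality_assoc]
    refine h.trans ?_
    rw [← δ_natural_assoc, MonoidalCategory.tensorHom_def']
    simp only [Category.assoc]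
    rw [← whisker_exchange_assoc, ← rightUnitor_naturality_assoc (δ F _ _),
      rightUnitor_naturality_assoc (F.map i.hom), rightUnitor_tensor_hom]
    simp only [Category.assoc, MonoidalCategory.whiskerLeft_comp]
  let e : internalEnd adjH ≅ unitAlgebra G := Mon.mkIso i (by
    rw [unitAlgebra_one]; exact hone) hmul
  exact ⟨e, hi⟩

end InternalEnd

/-! ### The reconstruction theorem -/

/-- The progenerator hypothesis in terms of `F`, which is isomorphic to `V ↦ F(V) ⊗ 𝟙`. -/
lemma exists_conservative_rightAdjoint {A : Type u₁} [Category.{v} A] [MonoidalCategory A]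
    {B : Type u₂} [Category.{v} B] [MonoidalCategory B] {F : A ⥤ B} [F.Monoidal]
    (hF : letI : MonoidalLeftAction A B := inducedAction F; IsProgenerator A (𝟙_ B)) :
    ∃ (H : B ⥤ A) (_ : F ⊣ H), H.ReflectsIsomorphisms ∧ PreservesColimitsOfSize.{v, v} H := by
  let : MonoidalLeftAction A B := inducedAction F
  obtain ⟨H, adj, h⟩ := hF
  exact ⟨H, adj.ofNatIsoLeft (actUnitIso F), h⟩

end TensorReconstruction

theorem mainTheorem8 (k : Type w) [Field k]
    (A : Type u₁) [Category.{v} A] [MonoidalCategory A] [Preadditive A] [Linear k A]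
    [MonoidalPreadditive A] [MonoidalLinear k A] [IsPrTensorCategory A] [IsRigid A]
    (B : Type u₂) [Category.{v} B] [MonoidalCategory B] [Preadditive B] [Linear k B]
    [MonoidalPreadditive B] [MonoidalLinear k B] [IsPrTensorCategory B]
    (F : A ⥤ B) [F.Monoidal] [IsPrTensorFunctor k F]
    (hF : letI : MonoidalLeftAction A B := inducedAction F; IsProgenerator A (𝟙_ B)) :
    F.IsLeftAdjoint ∧
    ∀ (G : B ⥤ A) (adj : F ⊣ G),
      letI : G.LaxMonoidal := adj.rightAdjointLaxMonoidal
      -- `G(𝟙)` is the internal endomorphism algebra of `𝟙`, compatibly with the evaluation maps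
      (letI : MonoidalLeftAction A B := inducedAction F
        ∀ (H : B ⥤ A) (adjH : act A (𝟙_ B) ⊣ H),
          ∃ e : internalEnd adjH ≅ unitAlgebra G,
            evalMap adjH =
              (ρ_ (F.obj (H.obj (𝟙_ B)))).hom ≫ F.map e.hom.hom ≫ adj.counit.app (𝟙_ B)) ∧
      -- `B` is the category of left `G(𝟙)`-modules; `F` is the free functor, `G` the forgetful one
      ((toLeftMod G).IsEquivalence ∧
        (∃ φ : freeLeft (unitAlgebra G) ≅ F ⋙ toLeftMod G, ∀ V : A,
          (φ.hom.app V).hom = leftExchange adj V ≫ G.map (λ_ (F.obj V)).hom) ∧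
        (∃ ψ : toLeftMod G ⋙ Mod.forget (unitAlgebra G).X ≅ G, ∀ b : B,
          ψ.hom.app b = 𝟙 (G.obj b))) ∧
      -- the same for right modules
      ((toRightMod G).IsEquivalence ∧
        (∃ φ : RightMod.free (unitAlgebra G) ≅ F ⋙ toRightMod G, ∀ V : A,
          (φ.hom.app V).hom = rightExchange adj V ≫ G.map (ρ_ (F.obj V)).hom) ∧
        (∃ ψ : toRightMod G ⋙ RightMod.forget (unitAlgebra G) ≅ G, ∀ b : B,
          ψ.hom.app b = 𝟙 (G.obj b))) ∧
      -- the exchange isomorphisms relate the left and the right action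
      (∃ (eL : tensorLeft (G.obj (𝟙_ B)) ≅ F ⋙ tensorLeft (𝟙_ B) ⋙ G)
          (eR : tensorRight (G.obj (𝟙_ B)) ≅ F ⋙ tensorRight (𝟙_ B) ⋙ G),
        (∀ V : A, eL.hom.app V = leftExchange adj V) ∧
        (∀ V : A, eR.hom.app V = rightExchange adj V) ∧
        (∀ b : B, leftAct G b =
          eL.hom.app (G.obj b) ≫ G.map ((λ_ (F.obj (G.obj b))).hom ≫ adj.counit.app b)) ∧
        (∀ b : B, rightAct G b =
          eR.hom.app (G.obj b) ≫ G.map ((ρ_ (F.obj (G.obj b))).hom ≫ adj.counit.app b)) ∧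
        (∀ b : B, leftAct G b =
          eL.hom.app (G.obj b) ≫
            G.map ((λ_ (F.obj (G.obj b))).hom ≫ (ρ_ (F.obj (G.obj b))).inv) ≫
              eR.inv.app (G.obj b) ≫ rightAct G b)) ∧
      -- the two actions commute
      (∀ b : B, leftAct G b ▷ G.obj (𝟙_ B) ≫ rightAct G b =
        (α_ (G.obj (𝟙_ B)) (G.obj b) (G.obj (𝟙_ B))).hom ≫
          G.obj (𝟙_ B) ◁ rightAct G b ≫ leftAct G b) ∧
      -- the functor to bimodules is faithful, `k`-linear, cocontinuous
      (toBimod G).Faithful ∧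
      (∀ (b c : B) (f g : b ⟶ c),
        ((toBimod G).map (f + g)).hom = ((toBimod G).map f).hom + ((toBimod G).map g).hom) ∧
      (∀ (b c : B) (r : k) (f : b ⟶ c),
        ((toBimod G).map (r • f)).hom = r • ((toBimod G).map f).hom) ∧
      PreservesColimitsOfSize.{v, v} (toBimod G) ∧
      -- and strong monoidal for the relative tensor product, with structure maps induced by
      -- the lax monoidal structure of `G`
      ∃ _ : (toBimod G).Monoidal,
        (Functor.LaxMonoidal.ε (toBimod G)).hom = 𝟙 (G.obj (𝟙_ B)) ∧
        ∀ b c : B,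
          relTensorProj ((toBimod G).obj b) ((toBimod G).obj c) ≫
            (Functor.LaxMonoidal.μ (toBimod G) b c).hom = Functor.LaxMonoidal.μ G b c := by
  obtain ⟨H, adjH, hH, hH'⟩ := exists_conservative_rightAdjoint hF
  refine ⟨⟨H, ⟨adjH⟩⟩, fun G adj => ?_⟩
  let : G.LaxMonoidal := adj.rightAdjointLaxMonoidal
  have : G.ReflectsIsomorphisms := reflectsIsomorphisms_of_iso (adjH.rightAdjointUniq adj)
  have : PreservesColimitsOfSize.{v, v} G := preservesColimits_of_natIso (adjH.rightAdjointUniq adj)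
  have : PreservesColimitsOfSize.{0, 0} G := preservesColimitsOfSize_of_univLE.{v, v} G
  have := (IsPrTensorCategory.locallyFinitelyPresentable (C := B)).toHasColimitsOfSize
  have := IsPrTensorCategory.tensorLeft_cocontinuous (C := A)
  have := IsPrTensorCategory.tensorRight_cocontinuous (C := A)
  -- The projection formulas at `b = 𝟙` are the exchange isomorphisms.
  have hR := isIso_rightProj_of_isRigid adj
  have hL := isIso_leftProj_of_isRigid adj
  have (V : A) : IsIso (leftExchange adj V) := hR (𝟙_ B) V
  have (V : A) : IsIso (rightExchange adj V) := hL (𝟙_ B) V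
  have (V : A) : IsIso (leftFreeMap adj V) := by unfold leftFreeMap; infer_instance
  have (V : A) : IsIso (rightFreeMap adj V) := by unfold rightFreeMap; infer_instance
  have := isEquivalence_comparison adj
  have : G.Faithful := faithful_of_comparison adj
  have : F.Additive := IsPrTensorFunctor.additive k
  have : F.Linear k := IsPrTensorFunctor.linear
  have : G.Additive := adj.right_adjoint_additive
  refine ⟨fun H' adjH' => exists_internalEnd_iso adj adjH', ⟨isEquivalence_toLeftMod adj, ?_, ?_⟩,
    ⟨isEquivalence_toRightMod adj, ?_, ?_⟩, ?_, leftAct_rightAct G, ?_, ?_, ?_,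
    preservesColimits_toBimod G, ?_⟩
  · exact ⟨freeLeftIso adj, fun _ => rfl⟩
  · exact ⟨Iso.refl _, fun _ => rfl⟩
  · exact ⟨freeRightIso adj, fun _ => rfl⟩
  · exact ⟨Iso.refl _, fun _ => rfl⟩
  · let eL : tensorLeft (G.obj (𝟙_ B)) ≅ F ⋙ tensorLeft (𝟙_ B) ⋙ G :=
      NatIso.ofComponents (fun V => asIso (leftExchange adj V))
        (fun f => rightProj_naturality adj (𝟙_ B) f)
    let eR : tensorRight (G.obj (𝟙_ B)) ≅ F ⋙ tensorRight (𝟙_ B) ⋙ G :=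
      NatIso.ofComponents (fun V => asIso (rightExchange adj V))
        (fun f => leftProj_naturality adj (𝟙_ B) f)
    have hl (b : B) : leftAct G b = leftExchange adj (G.obj b) ≫
        G.map ((λ_ (F.obj (G.obj b))).hom ≫ adj.counit.app b) := by
      rw [← leftFreeMap_counit adj b, leftFreeMap, Category.assoc, G.map_comp]
    have hr (b : B) : rightAct G b = rightExchange adj (G.obj b) ≫
        G.map ((ρ_ (F.obj (G.obj b))).hom ≫ adj.counit.app b) := by
      rw [← rightFreeMap_counit adj b, rightFreeMap, Category.assoc, G.map_comp]
    refine ⟨eL, eR, fun _ => rfl, fun _ => rfl, hl, hr, fun b => ?_⟩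
    change leftAct G b = leftExchange adj (G.obj b) ≫
      G.map ((λ_ (F.obj (G.obj b))).hom ≫ (ρ_ (F.obj (G.obj b))).inv) ≫
        inv (rightExchange adj (G.obj b)) ≫ rightAct G b
    rw [hl, hr, IsIso.inv_hom_id_assoc, ← G.map_comp, Category.assoc, Iso.inv_hom_id_assoc]
  · exact ⟨fun h => G.map_injective (congrArg Bimod.Hom.hom h)⟩
  · exact fun _ _ _ _ => G.map_add
  · -- Linearity of `G` is checked on adjuncts, where it is linearity of `F`.
    intro b c r f
    change G.map (r • f) = r • G.map f
    have h₁ := adj.counit.naturality f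
    have h₂ := adj.counit.naturality (r • f)
    dsimp at h₁ h₂
    apply (adj.homEquiv _ _).symm.injective
    rw [adj.homEquiv_counit, adj.homEquiv_counit, F.map_smul, Linear.smul_comp, h₁, h₂,
      Linear.comp_smul]
  · let core := toBimodCoreMonoidal (fun b c => isColimitBalancedCofork adj b c)
    refine ⟨core.toMonoidal, rfl, fun b c => ?_⟩
    exact relTensorProj_toBimodTensorIso _ b c
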